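/- Let $m\neq 0$ be real and let $a_0=1,a_1,a_2,\dots$ be real numbers. Consider the field diffeomorphism $F(\phi)=\sum_{k\ge 0}a_k\phi^{k+1}$, tangent to the identity, and the transformed free massive scalar theory in four-dimensional Minkowski space, with Lagrangian density $L_F(\phi)=\frac12\partial_\mu F(\phi)\,\partial^\mu F(\phi)-\frac{m^2}{2}F(\phi)^2$. Its Feynman rules are as follows. An internal edge with momentum $q$ contributes the propagator $\frac{i}{q^2-m^2}$. A vertex of valence $k\ge 3$ whose incident edges carry the momenta $q_1,\dots,q_k$ contributes the sum of the kinematic and the massive vertex, $$ i\,\frac{d_{k-2}}{2}\,(q_1^2+\cdots+q_k^2)+i\,c_{k-2},$$ $$ d_k=k!\sum_{j=0}^{k}(j+1)(k-j+1)\,a_ja_{k-j},\qquad c_k=-m^2\,\frac{(k+2)!}{2}\sum_{j=0}^{k}a_ja_{k-j}.$$ External edges contribute no factor. Here $q^2=q_{(0)}^2-q_{(1)}^2-q_{(2)}^2-q_{(3)}^2$ for $q\in\mathbb C^4$ (real momenta are a special case). Let $n\ge 3$ and let $p_1,\dots,p_n\in\mathbb C^4$ be (incoming) external momenta with $p_1+\cdots+p_n=0$.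 The tree-level $n$-point amplitude $A_n(p_1,\dots,p_n)$ is the sum, over all trees $T$ with $n$ labelled external edges and unlabelled vertices all of valence at least $3$ (up to isomorphisms fixing the external edges), of the product of the factors of the vertices and internal edges of $T$. The momenta of the internal edges are determined by momentum conservation at each vertex: an internal edge carries, up to sign, the sum of the external momenta on one side of it. Then the on-shell amplitude vanishes: if $p_i^2=m^2$ for every $i$, and no internal propagator is singular, that is, $\left(\sum_{i\in S}p_i\right)^2\neq m^2$ for every $S\subseteq\{1,\dots,n\}$ with $2\le |S|\le n-2$, then $$A_n(p_1,\dots,p_n)=0 .$$ -/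

import Mathlib

open Finset

/-! ### The field diffeomorphism and its Feynman rules -/

/-- The field diffeomorphism `F(φ) = a₀ φ + a₁ φ² + a₂ φ³ + ⋯` as a formal power series in `φ`;
it is tangent to the identity when `a 0 = 1`. -/
noncomputable def fieldDiffeo (a : ℕ → ℝ) : PowerSeries ℝ :=
  PowerSeries.X * PowerSeries.mk a

/-- The coefficient `d_k = k! ∑_{j=0}^{k} (j+1)(k-j+1) a_j a_{k-j}` of the kinematic vertex of
valence `k + 2`. -/
def kinematicCoeff (a : ℕ → ℝ) (k : ℕ) : ℝ :=
  (k.factorial : ℝ) *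
    ∑ j ∈ Finset.range (k + 1), ((j : ℝ) + 1) * ((k : ℝ) - j + 1) * (a j * a (k - j))

/-- The coefficient `c_k = -m² ((k+2)! / 2) ∑_{j=0}^{k} a_j a_{k-j}` of the massive vertex of
valence `k + 2`. -/
noncomputable def massiveCoeff (a : ℕ → ℝ) (m : ℝ) (k : ℕ) : ℝ :=
  -m ^ 2 * (((k + 2).factorial : ℝ) / 2) * ∑ j ∈ Finset.range (k + 1), a j * a (k - j)

/-- `½ (∂F(φ))² = ½ F'(φ)² (∂φ)²`, and `d_k / k!` is the coefficient of `φ^k` in `F'(φ)²`. -/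
theorem kinematicCoeff_eq (a : ℕ → ℝ) (k : ℕ) :
    kinematicCoeff a k = (k.factorial : ℝ) *
      PowerSeries.coeff k (PowerSeries.derivative ℝ (fieldDiffeo a) ^ 2) := by
  unfold kinematicCoeff fieldDiffeo
  rw [pow_two, PowerSeries.coeff_mul, Finset.Nat.sum_antidiagonal_eq_sum_range_succ_mk]
  congr 1
  refine Finset.sum_congr rfl fun j hj => ?_
  have hjk : j ≤ k := Nat.lt_succ_iff.1 (Finset.mem_range.1 hj)
  simp only [PowerSeries.coeff_derivative, PowerSeries.coeff_succ_X_mul, PowerSeries.coeff_mk]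
  rw [Nat.cast_sub hjk]
  ring

/-- `c_k` is `(k+2)!` times the coefficient of `φ^(k+2)` in `-(m²/2) F(φ)²`. -/
theorem massiveCoeff_eq (a : ℕ → ℝ) (m : ℝ) (k : ℕ) :
    massiveCoeff a m k = ((k + 2).factorial : ℝ) *
      (-(m ^ 2 / 2) * PowerSeries.coeff (k + 2) (fieldDiffeo a ^ 2)) := by
  have h : fieldDiffeo a ^ 2
      = PowerSeries.X ^ 2 * (PowerSeries.mk a * PowerSeries.mk a) := by
    unfold fieldDiffeo; ring
  rw [h, PowerSeries.coeff_X_pow_mul, PowerSeries.coeff_mul,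
    Finset.Nat.sum_antidiagonal_eq_sum_range_succ_mk]
  simp only [PowerSeries.coeff_mk, massiveCoeff]
  ring

/-! ### Momenta -/

/-- Complexified four-momenta (real momenta are the special case of real components). -/
abbrev Momentum : Type := Fin 4 → ℂ

/-- The (bilinear, not sesquilinear) Minkowski square `p² = p₀² - p₁² - p₂² - p₃²`. -/
def minkowskiSq (p : Momentum) : ℂ := p 0 ^ 2 - p 1 ^ 2 - p 2 ^ 2 - p 3 ^ 2

theorem minkowskiSq_neg (p : Momentum) : minkowskiSq (-p) = minkowskiSq p := by
  simp [minkowskiSq]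

/-- Momenta of `n` labelled external edges, all incoming, with overall momentum conservation. -/
structure ExternalMomenta (n : ℕ) where
  mom : Fin n → Momentum
  sum_eq_zero : ∑ i, mom i = 0

/-- Every external edge is on the mass shell, `p_i² = m²`. -/
def ExternalMomenta.OnShell {n : ℕ} (p : ExternalMomenta n) (m : ℝ) : Prop :=
  ∀ i, minkowskiSq (p.mom i) = (m : ℂ) ^ 2

/-- No propagator of an internal tree edge is singular.  Such an edge splits the external edges
into two sets of at least two elements each, and carries the total momentum of either of them. -/
def ExternalMomenta.Nonsingular {n : ℕ} (p : ExternalMomenta n) (m : ℝ) : Prop :=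
  ∀ S : Finset (Fin n), 2 ≤ #S → 2 ≤ #Sᶜ → minkowskiSq (∑ i ∈ S, p.mom i) ≠ (m : ℂ) ^ 2

/-! ### Trees -/

open Classical in
/-- The number of edges, internal and external, incident to the vertex `v`, where the internal
edges are those of `G` and the external edge `i` is attached at the vertex `att i`. -/
noncomputable def valenceAt {n r : ℕ} (G : SimpleGraph (Fin r)) (att : Fin n → Fin r)
    (v : Fin r) : ℕ :=
  #{w | G.Adj v w} + #{i | att i = v}

/-- A tree with `n` labelled external edges and with interaction vertices, each of valence at least
three, that are numbered by `Fin r`. The edges of `graph` are the internal edges; an external edge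
is given by the vertex at which it is attached. -/
structure NumberedTree (n r : ℕ) where
  graph : SimpleGraph (Fin r)
  isTree : graph.IsTree
  attach : Fin n → Fin r
  three_le_valence : ∀ v, 3 ≤ valenceAt graph attach v

namespace NumberedTree

variable {n r : ℕ}

noncomputable def valence (t : NumberedTree n r) (v : Fin r) : ℕ := valenceAt t.graph t.attach v

/-- Such a tree has at most `n - 2` vertices. -/
theorem add_two_le (t : NumberedTree n r) : r + 2 ≤ n := by
  classical
  have h1 : ∑ v, #{w | t.graph.Adj v w} = 2 * #t.graph.edgeFinset := by
    rw [← t.graph.sum_degrees_eq_twice_card_edges]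
    refine Finset.sum_congr rfl fun v _ => ?_
    rw [← SimpleGraph.card_neighborFinset_eq_degree]
    congr 1
    ext w
    simp
  have h2 : #t.graph.edgeFinset + 1 = r := by
    have := t.isTree.card_edgeFinset
    simpa using this
  have h3 : ∑ v, #{i | t.attach i = v} = n := by
    have := Finset.card_eq_sum_card_fiberwise (f := t.attach)
      (s := (Finset.univ : Finset (Fin n))) (t := (Finset.univ : Finset (Fin r))) (by simp)
    simpa using this.symm
  have h4 : ∑ _v : Fin r, 3 ≤ ∑ v, valenceAt t.graph t.attach v :=
    Finset.sum_le_sum fun v _ => t.three_le_valence v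
  have h5 : ∑ v, valenceAt t.graph t.attach v
      = ∑ v, #{w | t.graph.Adj v w} + ∑ v, #{i | t.attach i = v} := by
    rw [← Finset.sum_add_distrib]
    refine Finset.sum_congr rfl fun v _ => ?_
    unfold valenceAt
    congr!
  simp only [Finset.sum_const, Finset.card_univ, Fintype.card_fin, smul_eq_mul] at h4
  omega

/-- `t.Beyond v w x`: the vertex `x` lies on the side of `w` after removal of the edge `v w`. -/
def Beyond (t : NumberedTree n r) (v w x : Fin r) : Prop :=
  (t.graph.deleteEdges {s(v, w)}).Reachable w x

open Classical in
/-- The momentum that flows into the vertex `v` through the internal edge from `w`: the sum of the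
external momenta on the side of `w`. -/
noncomputable def flow (t : NumberedTree n r) (p : ExternalMomenta n) (v w : Fin r) : Momentum :=
  ∑ i with t.Beyond v w (t.attach i), p.mom i

theorem beyond_or (t : NumberedTree n r) (v w x : Fin r) :
    t.Beyond v w x ∨ t.Beyond w v x := by
  obtain ⟨q⟩ := t.isTree.connected.preconnected x v
  induction q with
  | nil => exact Or.inr (SimpleGraph.Reachable.refl _)
  | @cons x y z hxy q ih =>
    by_cases he : s(x, y) = s(z, w)
    · rcases Sym2.eq_iff.1 he with ⟨rfl, _⟩ | ⟨rfl, _⟩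
      · exact Or.inr (SimpleGraph.Reachable.refl _)
      · exact Or.inl (SimpleGraph.Reachable.refl _)
    · rcases ih with h | h
      · refine Or.inl (h.trans (SimpleGraph.Adj.reachable ?_))
        rw [SimpleGraph.deleteEdges_adj]
        exact ⟨hxy.symm, fun h' => he (Sym2.eq_swap.trans h')⟩
      · refine Or.inr (h.trans (SimpleGraph.Adj.reachable ?_))
        rw [SimpleGraph.deleteEdges_adj]
        exact ⟨hxy.symm, fun h' => he (Sym2.eq_swap.trans (h'.trans Sym2.eq_swap))⟩

theorem not_beyond_self (t : NumberedTree n r) {v w : Fin r} (h : t.graph.Adj v w) :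
    ¬ t.Beyond v w v := by
  intro hb
  have h1 := SimpleGraph.isAcyclic_iff_forall_adj_isBridge.1 t.isTree.isAcyclic h
  exact (SimpleGraph.isBridge_iff.1 h1) hb.symm

theorem not_beyond_and (t : NumberedTree n r) {v w : Fin r} (h : t.graph.Adj v w) (x : Fin r) :
    ¬ (t.Beyond v w x ∧ t.Beyond w v x) := by
  rintro ⟨h1, h2⟩
  unfold Beyond at h2
  rw [Sym2.eq_swap] at h2
  exact t.not_beyond_self h (h1.trans h2.symm)

/-- Reversing the orientation of an internal edge reverses the sign of its momentum. -/
theorem flow_swap (t : NumberedTree n r) (p : ExternalMomenta n) {v w : Fin r}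
    (h : t.graph.Adj v w) : t.flow p w v = -t.flow p v w := by
  classical
  rw [eq_neg_iff_add_eq_zero, ← p.sum_eq_zero, flow, flow,
    ← Finset.sum_filter_add_sum_filter_not Finset.univ (fun i => t.Beyond w v (t.attach i))]
  congr 1
  refine Finset.sum_congr ?_ fun _ _ => rfl
  ext i
  have h1 := t.beyond_or v w (t.attach i)
  have h2 := t.not_beyond_and h (t.attach i)
  simp only [Finset.mem_filter, Finset.mem_univ, true_and]
  tauto

theorem exists_beyond (t : NumberedTree n r) (v x : Fin r) :
    x = v ∨ ∃ w, t.graph.Adj v w ∧ t.Beyond v w x := by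
  obtain ⟨q⟩ := t.isTree.connected.preconnected x v
  induction q with
  | nil => exact Or.inl rfl
  | @cons x y z hxy q ih =>
    rcases ih with rfl | ⟨w, hw, hb⟩
    · exact Or.inr ⟨x, hxy.symm, SimpleGraph.Reachable.refl _⟩
    · by_cases he : s(y, x) = s(z, w)
      · rcases Sym2.eq_iff.1 he with ⟨_, rfl⟩ | ⟨_, rfl⟩
        · exact Or.inr ⟨x, hw, SimpleGraph.Reachable.refl _⟩
        · exact Or.inl rfl
      · refine Or.inr ⟨w, hw, hb.trans (SimpleGraph.Adj.reachable ?_)⟩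
        rw [SimpleGraph.deleteEdges_adj]
        exact ⟨hxy.symm, by simpa using he⟩

theorem beyond_unique (t : NumberedTree n r) {v w w' x : Fin r} (hw : t.graph.Adj v w)
    (hw' : t.graph.Adj v w') (hb : t.Beyond v w x) (hb' : t.Beyond v w' x) : w = w' := by
  by_contra hne
  have key : ∀ y z, (t.graph.deleteEdges {s(v, w')}).Walk y z → z = w' →
      (t.graph.deleteEdges {s(v, w)}).Reachable w' y := by
    intro y z q
    induction q with
    | nil => rintro rfl; exact SimpleGraph.Reachable.refl _
    | @cons y z u hyz q ih =>
      rintro hu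
      have hz : t.Beyond v w' z := by
        have h := q.reverse
        rw [hu] at h
        exact ⟨h⟩
      have hy' : t.Beyond v w' y := hz.trans hyz.symm.reachable
      refine (ih hu).trans (SimpleGraph.Adj.reachable ?_)
      rw [SimpleGraph.deleteEdges_adj]
      refine ⟨(SimpleGraph.deleteEdges_adj.1 hyz).1.symm, fun he => ?_⟩
      rcases Sym2.eq_iff.1 (Set.mem_singleton_iff.1 he) with ⟨rfl, _⟩ | ⟨_, rfl⟩
      · exact t.not_beyond_self hw' hz
      · exact t.not_beyond_self hw' hy'
  have h1 : (t.graph.deleteEdges {s(v, w)}).Reachable w' v := by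
    refine SimpleGraph.Adj.reachable ?_
    rw [SimpleGraph.deleteEdges_adj]
    refine ⟨hw'.symm, fun he => ?_⟩
    rcases Sym2.eq_iff.1 (Set.mem_singleton_iff.1 he) with ⟨h2, _⟩ | ⟨h2, _⟩
    · exact hw'.ne h2.symm
    · exact hne h2.symm
  obtain ⟨q⟩ := hb'.symm
  exact t.not_beyond_self hw (hb.trans ((key x w' q rfl).symm.trans h1))

open Classical in
/-- Momentum is conserved at every vertex. -/
theorem flow_conservation (t : NumberedTree n r) (p : ExternalMomenta n) (v : Fin r) :
    ∑ w with t.graph.Adj v w, t.flow p v w + ∑ i with t.attach i = v, p.mom i = 0 := by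
  rw [← p.sum_eq_zero,
    ← Finset.sum_filter_not_add_sum_filter Finset.univ (fun i => t.attach i = v)]
  congr 1
  unfold flow
  simp_rw [Finset.sum_filter (fun i => t.Beyond _ _ (t.attach i))]
  rw [Finset.sum_comm, Finset.sum_filter]
  refine Finset.sum_congr rfl fun i _ => ?_
  rcases eq_or_ne (t.attach i) v with h | h
  · rw [if_neg (by simpa using h)]
    refine Finset.sum_eq_zero fun w hw => if_neg ?_
    rw [h]
    exact t.not_beyond_self (by simpa using hw)
  · obtain ⟨w, hw, hb⟩ := (t.exists_beyond v (t.attach i)).resolve_left h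
    rw [if_pos (by simpa using h), Finset.sum_eq_single w, if_pos hb]
    · intro w' hw' hne
      refine if_neg fun hb' => hne ?_
      exact t.beyond_unique (by simpa using hw') hw hb' hb
    · intro h'
      simp [hw] at h'

/-! ### Feynman rules -/

open Classical in
/-- The combined vertex `i (d_{k-2}/2) (q₁² + ⋯ + q_k²) + i c_{k-2}`, where `k` is the valence and
`q₁, …, q_k` are the momenta of the incident internal and external edges. -/
noncomputable def vertexFactor (a : ℕ → ℝ) (m : ℝ) (p : ExternalMomenta n) (t : NumberedTree n r)
    (v : Fin r) : ℂ :=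
  Complex.I * ((kinematicCoeff a (t.valence v - 2) : ℂ) / 2) *
      (∑ w with t.graph.Adj v w, minkowskiSq (t.flow p v w) +
        ∑ i with t.attach i = v, minkowskiSq (p.mom i)) +
    Complex.I * (massiveCoeff a m (t.valence v - 2) : ℂ)

/-- The propagator `i / (q² - m²)` of the internal edge between `v` and `w`. -/
noncomputable def propagator (m : ℝ) (p : ExternalMomenta n) (t : NumberedTree n r)
    (v w : Fin r) : ℂ :=
  Complex.I / (minkowskiSq (t.flow p v w) - (m : ℂ) ^ 2)

open Classical in
/-- The contribution of a tree: the product of its vertices and of the propagators of its internal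
edges (each internal edge is listed once, by its endpoints `v < w`). -/
noncomputable def contribution (a : ℕ → ℝ) (m : ℝ) (p : ExternalMomenta n)
    (t : NumberedTree n r) : ℂ :=
  (∏ v, vertexFactor a m p t v) *
    ∏ e : Fin r × Fin r with e.1 < e.2 ∧ t.graph.Adj e.1 e.2, propagator m p t e.1 e.2

/-- Two trees are identified if they differ only in the numbering of the vertices: a graph
isomorphism that respects the labelled external edges takes one to the other. -/
def Equivalent (t t' : NumberedTree n r) : Prop :=
  ∃ f : t.graph ≃g t'.graph, ∀ i, t'.attach i = f (t.attach i)

instance setoid (n r : ℕ) : Setoid (NumberedTree n r) where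
  r := Equivalent
  iseqv :=
    { refl := fun t => ⟨SimpleGraph.Iso.refl, fun _ => rfl⟩
      symm := by
        rintro t t' ⟨f, hf⟩
        exact ⟨f.symm, fun i => by rw [hf]; exact (f.symm_apply_apply _).symm⟩
      trans := by
        rintro t t' t'' ⟨f, hf⟩ ⟨g, hg⟩
        exact ⟨f.trans g, fun i => by rw [hg, hf]; rfl⟩ }

theorem beyond_iso {t t' : NumberedTree n r} (f : t.graph ≃g t'.graph) {v w x : Fin r}
    (h : t.Beyond v w x) : t'.Beyond (f v) (f w) (f x) := by
  have key : ∀ y z, (t.graph.deleteEdges {s(v, w)}).Walk y z →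
      (t'.graph.deleteEdges {s(f v, f w)}).Reachable (f y) (f z) := by
    intro y z q
    induction q with
    | nil => exact SimpleGraph.Reachable.refl _
    | cons hxy q ih =>
      refine (SimpleGraph.Adj.reachable ?_).trans ih
      rw [SimpleGraph.deleteEdges_adj] at hxy ⊢
      refine ⟨f.map_adj_iff.2 hxy.1, fun he => hxy.2 ?_⟩
      rw [Set.mem_singleton_iff, Sym2.eq_iff] at he ⊢
      simpa only [EmbeddingLike.apply_eq_iff_eq] using he
  obtain ⟨q⟩ := h
  exact key w x q

theorem beyond_iso_iff {t t' : NumberedTree n r} (f : t.graph ≃g t'.graph) (v w x : Fin r) :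
    t'.Beyond (f v) (f w) (f x) ↔ t.Beyond v w x :=
  ⟨fun h => by simpa using beyond_iso f.symm h, beyond_iso f⟩

open Classical in
theorem flow_iso (p : ExternalMomenta n) {t t' : NumberedTree n r} (f : t.graph ≃g t'.graph)
    (hf : ∀ i, t'.attach i = f (t.attach i)) (v w : Fin r) :
    t'.flow p (f v) (f w) = t.flow p v w := by
  unfold flow
  refine Finset.sum_congr ?_ fun _ _ => rfl
  ext i
  rw [Finset.mem_filter, Finset.mem_filter, hf, beyond_iso_iff f]

open Classical in
theorem valence_iso {t t' : NumberedTree n r} (f : t.graph ≃g t'.graph)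
    (hf : ∀ i, t'.attach i = f (t.attach i)) (v : Fin r) : t'.valence (f v) = t.valence v := by
  unfold valence valenceAt
  congr 1
  · symm
    refine Finset.card_bij (fun w _ => f w) ?_ ?_ ?_
    · intro w hw
      simpa [f.map_adj_iff] using hw
    · intro w _ w' _ h
      exact f.injective h
    · intro w hw
      refine ⟨f.symm w, ?_, by simp⟩
      simp only [Finset.mem_filter, Finset.mem_univ, true_and] at hw ⊢
      rw [← f.map_adj_iff]
      simpa using hw
  · simp [hf]

theorem vertexFactor_iso (a : ℕ → ℝ) (m : ℝ) (p : ExternalMomenta n) {t t' : NumberedTree n r}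
    (f : t.graph ≃g t'.graph) (hf : ∀ i, t'.attach i = f (t.attach i)) (v : Fin r) :
    vertexFactor a m p t' (f v) = vertexFactor a m p t v := by
  classical
  have h : ∑ w with t'.graph.Adj (f v) w, minkowskiSq (t'.flow p (f v) w)
      = ∑ w with t.graph.Adj v w, minkowskiSq (t.flow p v w) := by
    rw [Finset.sum_filter, Finset.sum_filter, ← Equiv.sum_comp f.toEquiv]
    refine Finset.sum_congr rfl fun w _ => ?_
    have h1 := flow_iso p f hf v w
    have h2 := f.map_adj_iff (v := v) (w := w)
    simp only [RelIso.coe_fn_toEquiv, h1, h2]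
  unfold vertexFactor
  rw [valence_iso f hf]
  simp only [hf, EmbeddingLike.apply_eq_iff_eq]
  congr! 3

theorem propagator_swap (m : ℝ) (p : ExternalMomenta n) (t : NumberedTree n r) {v w : Fin r}
    (h : t.graph.Adj v w) : propagator m p t w v = propagator m p t v w := by
  rw [propagator, propagator, t.flow_swap p h, minkowskiSq_neg]

theorem contribution_congr (a : ℕ → ℝ) (m : ℝ) (p : ExternalMomenta n)
    (t t' : NumberedTree n r) (h : t ≈ t') : contribution a m p t = contribution a m p t' := by
  classical
  obtain ⟨f, hf⟩ := h
  have hprop : ∀ v w, propagator m p t' (f v) (f w) = propagator m p t v w := fun v w => by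
    rw [propagator, propagator, flow_iso p f hf]
  unfold contribution
  congr 1
  · rw [← Equiv.prod_comp f.toEquiv (fun v => vertexFactor a m p t' v)]
    exact Finset.prod_congr rfl fun v _ => (vertexFactor_iso a m p f hf v).symm
  · refine Finset.prod_bij
      (fun e _ => if f e.1 < f e.2 then (f e.1, f e.2) else (f e.2, f e.1)) ?_ ?_ ?_ ?_
    · rintro ⟨v, w⟩ he
      simp only [Finset.mem_filter, Finset.mem_univ, true_and] at he ⊢
      have hadj := f.map_adj_iff.2 he.2
      split_ifs with hlt
      · exact ⟨hlt, hadj⟩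
      · exact ⟨lt_of_le_of_ne (not_lt.1 hlt) hadj.ne.symm, hadj.symm⟩
    · rintro ⟨v, w⟩ he ⟨v', w'⟩ he' heq
      simp only [Finset.mem_filter, Finset.mem_univ, true_and] at he he' heq
      have h1 := he.1
      have h2 := he'.1
      split_ifs at heq <;>
        simp only [Prod.mk.injEq, EmbeddingLike.apply_eq_iff_eq] at heq <;>
        obtain ⟨rfl, rfl⟩ := heq
      · rfl
      · exact absurd h1 h2.asymm
      · exact absurd h1 h2.asymm
      · rfl
    · rintro ⟨v, w⟩ he
      simp only [Finset.mem_filter, Finset.mem_univ, true_and] at he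
      have hadj : t.graph.Adj (f.symm v) (f.symm w) := f.symm.map_adj_iff.2 he.2
      rcases lt_or_gt_of_ne hadj.ne with hlt | hlt
      · exact ⟨(f.symm v, f.symm w), by simp [hlt, hadj], by simp [he.1]⟩
      · exact ⟨(f.symm w, f.symm v), by simp [hlt, hadj.symm], by simp [he.1.not_gt]⟩
    · rintro ⟨v, w⟩ he
      simp only [Finset.mem_filter, Finset.mem_univ, true_and] at he
      split_ifs with hlt
      · exact (hprop v w).symm
      · rw [propagator_swap m p t' (f.map_adj_iff.2 he.2)]
        exact (hprop v w).symm

instance (n r : ℕ) : Finite (NumberedTree n r) :=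
  Finite.of_injective (fun t => (t.graph, t.attach)) fun t t' h => by
    cases t
    cases t'
    simpa using h

end NumberedTree

/-- Trees with `n` labelled external edges and `r` unlabelled vertices of valence at least three. -/
def FeynmanTree (n r : ℕ) : Type := Quotient (NumberedTree.setoid n r)

instance (n r : ℕ) : Finite (FeynmanTree n r) :=
  inferInstanceAs (Finite (Quotient (NumberedTree.setoid n r)))

noncomputable instance (n r : ℕ) : Fintype (FeynmanTree n r) := Fintype.ofFinite _

noncomputable def FeynmanTree.contribution {n r : ℕ} (a : ℕ → ℝ) (m : ℝ) (p : ExternalMomenta n) :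
    FeynmanTree n r → ℂ :=
  Quotient.lift (NumberedTree.contribution a m p) (NumberedTree.contribution_congr a m p)

/-- The tree-level `n`-point amplitude: the sum of the contributions of all trees with `n` labelled
external edges. A tree with more than `n - 2` vertices does not exist
(`NumberedTree.add_two_le`). -/
noncomputable def treeAmplitude (a : ℕ → ℝ) (m : ℝ) {n : ℕ} (p : ExternalMomenta n) : ℂ :=
  ∑ r ∈ Finset.range (n - 1), ∑ T : FeynmanTree n r, T.contribution a m p

/-! The field `F(φ)` is free, so the classical solutions of the transformed theory are `φ = G(ρ)`,
with `G` the compositional inverse of `F` and `ρ` a superposition of on-shell plane waves. Trees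
rooted at one external edge compute this solution perturbatively. Hence the current on a set `S` of
on-shell external edges (the sum over trees with leaves `S`, including the propagator of the root
edge) is `b #S`, the exponential coefficient of `G`: it does not depend on the momenta and has no
pole at `P_S² = m²`. The amplitude is the last current with its root propagator removed, that is, up
to a constant, `(P_S² - m²) b #S`, and this vanishes when the root edge is on shell.

The analytic half is `exists_perturbative_solution`. Faà di Bruno's formula turns sums over
partitions into compositions of power series. Expanding each `P_B²` into inner products splits the
equation into a part proportional to `m²` and a part proportional to `∑_{i ≠ j} q_i · q_j`. With `W'
= F'²` these vanish by `field_equation_mass` and `field_equation_pairs`, both consequences of `F'(G)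
G' = 1`. The trivial partition `{S}` contributes `(P_S² - m²) b #S`, the inverse propagator; moved
to the other side, it gives the recursion for the currents.

The combinatorial half identifies trees up to renumbering with hierarchies (laminar families) on the
external edges other than the root: a vertex corresponds to the set of leaves below it, and its
children and attached leaves to the maximal proper members of that set. Valence at least three makes
these leaf sets distinct and different from singletons. See `contribution_eq_hierarchyWeight`,
`equivalent_of_hierarchy_eq` and `exists_hierarchy_eq`, combined in
`treeAmplitude_eq_sum_hierarchies`. Decomposing a hierarchy at its top (`sum_hierarchies`) then
yields the same recursion over partitions. -/

/-! ### Exponential coefficients of power series -/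

/-- The `n`-th coefficient of `A` as an exponential generating function. -/
noncomputable def expCoeff (A : PowerSeries ℂ) (n : ℕ) : ℂ := (n.factorial : ℂ) * PowerSeries.coeff n A

theorem expCoeff_derivative (A : PowerSeries ℂ) (n : ℕ) :
    expCoeff (PowerSeries.derivative ℂ A) n = expCoeff A (n + 1) := by
  rw [expCoeff, expCoeff, PowerSeries.coeff_derivative, Nat.factorial_succ]
  push_cast
  ring

theorem expCoeff_add (A B : PowerSeries ℂ) (n : ℕ) :
    expCoeff (A + B) n = expCoeff A n + expCoeff B n := by
  simp [expCoeff, mul_add]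

theorem expCoeff_X_mul (A : PowerSeries ℂ) (n : ℕ) :
    expCoeff (PowerSeries.X * A) (n + 1) = (n + 1) * expCoeff A n := by
  rw [expCoeff, expCoeff, PowerSeries.coeff_succ_X_mul, Nat.factorial_succ]
  push_cast
  ring

/-- A product of exponential generating functions counts pairs of complementary subsets. -/
theorem sum_powerset_expCoeff_mul {α : Type*} [DecidableEq α] (A B : PowerSeries ℂ)
    (U : Finset α) :
    ∑ T ∈ U.powerset, expCoeff A #T * expCoeff B #(U \ T) = expCoeff (A * B) #U := by
  have h : ∀ T ∈ U.powerset, expCoeff A #T * expCoeff B #(U \ T)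
      = (fun k => expCoeff A k * expCoeff B (#U - k)) #T := fun T hT => by
    simp only [card_sdiff_of_subset (mem_powerset.1 hT)]
  rw [Finset.sum_congr rfl h,
    Finset.sum_powerset_apply_card (fun k => expCoeff A k * expCoeff B (#U - k)), expCoeff, PowerSeries.coeff_mul,
    Finset.Nat.sum_antidiagonal_eq_sum_range_succ_mk, Finset.mul_sum]
  refine Finset.sum_congr rfl fun k hk => ?_
  have hk' : k ≤ #U := Nat.lt_succ_iff.1 (Finset.mem_range.1 hk)
  rw [← Nat.choose_mul_factorial_mul_factorial hk', nsmul_eq_mul, expCoeff, expCoeff]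
  push_cast
  ring

/-! ### Set partitions -/

/-- The partitions of the finite set `S` into nonempty blocks. -/
def setPartitions {α : Type*} [DecidableEq α] (S : Finset α) : Finset (Finset (Finset α)) :=
  {π ∈ S.powerset.powerset | ∅ ∉ π ∧ (∀ i ∈ S, ∃ B ∈ π, i ∈ B) ∧
    ∀ B ∈ π, ∀ C ∈ π, ∀ i ∈ B, i ∈ C → B = C}

section SetPartitions

variable {α : Type*} [DecidableEq α]

theorem mem_setPartitions {S : Finset α} {π : Finset (Finset α)} :
    π ∈ setPartitions S ↔ (∀ B ∈ π, B ⊆ S) ∧ ∅ ∉ π ∧ (∀ i ∈ S, ∃ B ∈ π, i ∈ B) ∧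
      ∀ B ∈ π, ∀ C ∈ π, ∀ i ∈ B, i ∈ C → B = C := by
  simp only [setPartitions, Finset.mem_filter, Finset.mem_powerset, Finset.subset_iff (s₁ := π)]

theorem setPartitions_empty : setPartitions (∅ : Finset α) = {∅} := by
  ext π
  rw [mem_setPartitions, Finset.mem_singleton]
  constructor
  · rintro ⟨h1, h2, -⟩
    refine Finset.eq_empty_of_forall_notMem fun B hB => h2 ?_
    rwa [← Finset.subset_empty.1 (h1 B hB)]
  · rintro rfl
    simp

theorem insert_mem_setPartitions {S T : Finset α} {i : α} {π : Finset (Finset α)} (hi : i ∈ S)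
    (hT : T ⊆ S.erase i) (hπ : π ∈ setPartitions (S.erase i \ T)) :
    insert (insert i T) π ∈ setPartitions S := by
  rw [mem_setPartitions] at hπ ⊢
  obtain ⟨h1, h2, h3, h4⟩ := hπ
  have hnot : ∀ B ∈ π, ∀ j ∈ B, j ∉ insert i T := fun B hB j hj hj' => by
    have := h1 B hB hj
    simp only [Finset.mem_sdiff, Finset.mem_erase, Finset.mem_insert] at this hj'
    tauto
  refine ⟨?_, ?_, ?_, ?_⟩
  · intro B hB
    rcases Finset.mem_insert.1 hB with rfl | hB
    · exact Finset.insert_subset hi (hT.trans (Finset.erase_subset _ _))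
    · exact (h1 B hB).trans (Finset.sdiff_subset.trans (Finset.erase_subset _ _))
  · rw [Finset.mem_insert]
    rintro (h | h)
    · exact Finset.insert_ne_empty _ _ h.symm
    · exact h2 h
  · intro j hj
    by_cases hjT : j ∈ insert i T
    · exact ⟨_, Finset.mem_insert_self _ _, hjT⟩
    · have : j ∈ S.erase i \ T := by
        simp only [Finset.mem_sdiff, Finset.mem_erase, Finset.mem_insert] at hjT ⊢
        tauto
      obtain ⟨B, hB, hjB⟩ := h3 j this
      exact ⟨B, Finset.mem_insert_of_mem hB, hjB⟩
  · intro B hB C hC j hjB hjC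
    rcases Finset.mem_insert.1 hB with rfl | hB <;> rcases Finset.mem_insert.1 hC with rfl | hC
    · rfl
    · exact absurd hjB (hnot C hC j hjC)
    · exact absurd hjC (hnot B hB j hjB)
    · exact h4 B hB C hC j hjB hjC

theorem insert_notMem_of_mem_setPartitions {S T : Finset α} {i : α} {π : Finset (Finset α)}
    (hπ : π ∈ setPartitions (S.erase i \ T)) {B : Finset α} (hB : B ∈ π) : i ∉ B := fun h => by
  have := (mem_setPartitions.1 hπ).1 B hB h
  simp at this

/-- A partition of `S` consists of the block of a given element `i` and of a partition of the
complement of this block. -/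
theorem sum_setPartitions {M : Type*} [AddCommMonoid M] {S : Finset α} {i : α} (hi : i ∈ S)
    (f : Finset (Finset α) → M) :
    ∑ π ∈ setPartitions S, f π = ∑ T ∈ (S.erase i).powerset,
      ∑ π ∈ setPartitions (S.erase i \ T), f (insert (insert i T) π) := by
  rw [Finset.sum_sigma']
  symm
  refine Finset.sum_bij (fun x _ => insert (insert i x.1) x.2) ?_ ?_ ?_ ?_
  · rintro ⟨T, π⟩ hx
    rw [Finset.mem_sigma, Finset.mem_powerset] at hx
    exact insert_mem_setPartitions hi hx.1 hx.2
  · rintro ⟨T, π⟩ hx ⟨T', π'⟩ hx' h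
    rw [Finset.mem_sigma, Finset.mem_powerset] at hx hx'
    dsimp only at hx hx' h
    have hn : ∀ B ∈ π, i ∉ B := fun B hB => insert_notMem_of_mem_setPartitions hx.2 hB
    have hn' : ∀ B ∈ π', i ∉ B := fun B hB => insert_notMem_of_mem_setPartitions hx'.2 hB
    have hTT : insert i T = insert i T' := by
      have := h ▸ Finset.mem_insert_self (insert i T) π
      rcases Finset.mem_insert.1 this with h' | h'
      · exact h'
      · exact absurd (Finset.mem_insert_self _ _) (hn' _ h')
    have hiT : i ∉ T := fun h' => by simpa using hx.1 h'
    have hiT' : i ∉ T' := fun h' => by simpa using hx'.1 h'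
    have hT : T = T' := by
      rw [← Finset.erase_insert hiT, hTT, Finset.erase_insert hiT']
    subst hT
    have e : insert i T ∉ π := fun h' => hn _ h' (Finset.mem_insert_self _ _)
    have e' : insert i T ∉ π' := fun h' => hn' _ h' (Finset.mem_insert_self _ _)
    have hπ : π = π' := by rw [← Finset.erase_insert e, h, Finset.erase_insert e']
    rw [hπ]
  · intro π hπ
    rw [mem_setPartitions] at hπ
    obtain ⟨h1, h2, h3, h4⟩ := hπ
    obtain ⟨B, hB, hiB⟩ := h3 i hi
    have hBi : insert i (B.erase i) = B := Finset.insert_erase hiB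
    refine ⟨⟨B.erase i, π.erase B⟩, ?_, ?_⟩
    · rw [Finset.mem_sigma, Finset.mem_powerset, mem_setPartitions]
      refine ⟨Finset.erase_subset_erase _ (h1 B hB), ?_, ?_, ?_, ?_⟩
      · intro C hC j hj
        rw [Finset.mem_erase] at hC
        have hjB : j ∉ B := fun h => hC.1 (h4 C hC.2 B hB j hj h)
        have hjS := h1 C hC.2 hj
        simp only [Finset.mem_sdiff, Finset.mem_erase]
        refine ⟨⟨?_, hjS⟩, fun h => hjB h.2⟩
        rintro rfl
        exact hjB hiB
      · exact fun h => h2 (Finset.mem_of_mem_erase h)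
      · intro j hj
        simp only [Finset.mem_sdiff, Finset.mem_erase] at hj
        obtain ⟨C, hC, hjC⟩ := h3 j hj.1.2
        refine ⟨C, Finset.mem_erase.2 ⟨?_, hC⟩, hjC⟩
        rintro rfl
        exact hj.2 ⟨hj.1.1, hjC⟩
      · intro C hC D hD
        exact h4 C (Finset.mem_of_mem_erase hC) D (Finset.mem_of_mem_erase hD)
    · dsimp only
      rw [hBi, Finset.insert_erase hB]
  · intro x _
    rfl

/-- Marking `i` singles out its block `insert i T`, and `y` is an additional weight of that block.
The shifts by one become derivatives of exponential generating functions. -/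
theorem sum_setPartitions_prod {S : Finset α} {i : α} (hi : i ∈ S) (h : ℕ → ℂ) (b : ℕ → ℂ)
    (y : Finset α → ℂ) :
    ∑ π ∈ setPartitions S, h #π * (∏ B ∈ π, b #B) * ∑ B ∈ π with i ∈ B, y B
      = ∑ T ∈ (S.erase i).powerset, b (#T + 1) * y (insert i T) *
        ∑ π ∈ setPartitions (S.erase i \ T), h (#π + 1) * ∏ B ∈ π, b #B := by
  rw [sum_setPartitions hi]
  refine Finset.sum_congr rfl fun T hT => ?_
  rw [Finset.mul_sum]
  refine Finset.sum_congr rfl fun π hπ => ?_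
  have hn : ∀ B ∈ π, i ∉ B := fun B hB => insert_notMem_of_mem_setPartitions hπ hB
  have e : insert i T ∉ π := fun h' => hn _ h' (Finset.mem_insert_self _ _)
  have hiT : i ∉ T := fun h' => by simpa using Finset.mem_powerset.1 hT h'
  have hf : {B ∈ insert (insert i T) π | i ∈ B} = {insert i T} := by
    ext B
    simp only [Finset.mem_filter, Finset.mem_insert, Finset.mem_singleton]
    constructor
    · rintro ⟨h | h, h'⟩
      · exact h
      · exact absurd h' (hn B h)
    · rintro rfl
      exact ⟨Or.inl rfl, Finset.mem_insert_self _ _⟩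
  rw [hf, Finset.sum_singleton, Finset.prod_insert e, Finset.card_insert_of_notMem e,
    Finset.card_insert_of_notMem hiT]
  ring

theorem sum_filter_mem_setPartition {S : Finset α} {π : Finset (Finset α)}
    (hπ : π ∈ setPartitions S) {i : α} (hi : i ∈ S) : ∑ B ∈ π with i ∈ B, (1 : ℂ) = 1 := by
  obtain ⟨h1, h2, h3, h4⟩ := mem_setPartitions.1 hπ
  obtain ⟨B, hB, hiB⟩ := h3 i hi
  have : {C ∈ π | i ∈ C} = {B} := by
    ext C
    simp only [Finset.mem_filter, Finset.mem_singleton]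
    constructor
    · rintro ⟨hC, hiC⟩
      exact h4 C hC B hB i hiC hiB
    · rintro rfl
      exact ⟨hB, hiB⟩
  rw [this, Finset.sum_singleton]

/-- The chain rule in combinatorial order: `G'` counts the block of a marked element and `A'(G)` the
partition of the rest. -/
theorem derivative_subst_mul {A G : PowerSeries ℂ} (hG : PowerSeries.constantCoeff G = 0) :
    PowerSeries.derivative ℂ G * (PowerSeries.derivative ℂ A).subst G
      = PowerSeries.derivative ℂ (A.subst G) := by
  rw [PowerSeries.derivative_subst (PowerSeries.HasSubst.of_constantCoeff_zero' hG), mul_comm]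

/-- Faà di Bruno's formula: the composition of exponential generating functions counts
partitions. -/
theorem sum_setPartitions_expCoeff {G : PowerSeries ℂ} (hG : PowerSeries.constantCoeff G = 0)
    (A : PowerSeries ℂ) (S : Finset α) :
    ∑ π ∈ setPartitions S, expCoeff A #π * ∏ B ∈ π, expCoeff G #B = expCoeff (A.subst G) #S := by
  induction hs : #S using Nat.strong_induction_on generalizing S A with
  | _ s ih =>
    rcases S.eq_empty_or_nonempty with rfl | ⟨i, hi⟩
    · subst hs
      -- The constant term of `A(G)` is that of `A`: subtract it, and what remains substitutes to a
      -- series without constant term.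
      have h0 := PowerSeries.constantCoeff_subst_eq_zero (a := G) hG
        (A - PowerSeries.C (PowerSeries.constantCoeff A)) (by simp)
      rw [PowerSeries.subst_sub (PowerSeries.HasSubst.of_constantCoeff_zero' hG),
        PowerSeries.subst_C, map_sub, sub_eq_zero] at h0
      rw [setPartitions_empty]
      simp only [Finset.sum_singleton, Finset.card_empty, Finset.prod_empty, mul_one, expCoeff,
        Nat.factorial_zero, Nat.cast_one, one_mul]
      rw [PowerSeries.coeff_zero_eq_constantCoeff_apply,
        PowerSeries.coeff_zero_eq_constantCoeff_apply]
      simp only [MvPowerSeries.constantCoeff_C] at h0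
      exact h0.symm
    -- A factor `1`, written as the number of blocks containing `i`, gives the form in which the
    -- block of `i` can be split off.
    · have h1 : ∑ π ∈ setPartitions S, expCoeff A #π * ∏ B ∈ π, expCoeff G #B
          = ∑ π ∈ setPartitions S, expCoeff A #π * (∏ B ∈ π, expCoeff G #B) *
            ∑ B ∈ π with i ∈ B, (1 : ℂ) :=
        Finset.sum_congr rfl fun π hπ => by rw [sum_filter_mem_setPartition hπ hi, mul_one]
      have hc : #(S.erase i) + 1 = s := by rw [Finset.card_erase_add_one hi, hs]
      rw [h1, sum_setPartitions_prod hi _ _ (fun _ => 1), ← hc, ← expCoeff_derivative,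
        ← derivative_subst_mul hG, ← sum_powerset_expCoeff_mul]
      refine Finset.sum_congr rfl fun T hT => ?_
      have hlt : #(S.erase i \ T) < s :=
        lt_of_le_of_lt (Finset.card_le_card Finset.sdiff_subset) (by omega)
      rw [mul_one, ← ih _ hlt _ _ rfl, expCoeff_derivative]
      simp_rw [expCoeff_derivative]

/-- Double counting of pairs `j ∈ T ⊆ U`: choose `j` first, then the rest of `T`. -/
theorem sum_powerset_sum_mem (U : Finset α) (f : Finset α → ℂ) (g : α → ℂ) :
    ∑ T ∈ U.powerset, f T * ∑ j ∈ T, g j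
      = ∑ j ∈ U, g j * ∑ T ∈ (U.erase j).powerset, f (insert j T) := by
  simp_rw [Finset.mul_sum]
  rw [Finset.sum_comm' (t' := U) (s' := fun j => {T ∈ U.powerset | j ∈ T})]
  · refine Finset.sum_congr rfl fun j hj => ?_
    symm
    refine Finset.sum_bij (fun T _ => insert j T) ?_ ?_ ?_ ?_
    · intro T hT
      rw [Finset.mem_powerset] at hT
      rw [Finset.mem_filter, Finset.mem_powerset]
      exact ⟨Finset.insert_subset hj (hT.trans (Finset.erase_subset _ _)),
        Finset.mem_insert_self _ _⟩
    · intro T hT T' hT' h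
      rw [Finset.mem_powerset] at hT hT'
      have h1 : j ∉ T := fun h' => by simpa using hT h'
      have h2 : j ∉ T' := fun h' => by simpa using hT' h'
      rw [← Finset.erase_insert h1, h, Finset.erase_insert h2]
    · intro T hT
      rw [Finset.mem_filter, Finset.mem_powerset] at hT
      exact ⟨T.erase j, Finset.mem_powerset.2 (Finset.erase_subset_erase _ hT.1),
        Finset.insert_erase hT.2⟩
    · intro T hT
      ring
  · intro T j
    simp only [Finset.mem_powerset, Finset.mem_filter]
    constructor
    · rintro ⟨h1, h2⟩
      exact ⟨⟨h1, h2⟩, h1 h2⟩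
    · rintro ⟨⟨h1, h2⟩, -⟩
      exact ⟨h1, h2⟩

/-- Faà di Bruno's formula with an additional sum over the pairs of elements of the same block. -/
theorem sum_setPartitions_expCoeff_pairs {G : PowerSeries ℂ}
    (hG : PowerSeries.constantCoeff G = 0) (A : PowerSeries ℂ) (S : Finset α) (g : α → α → ℂ) :
    ∑ π ∈ setPartitions S, expCoeff A #π * (∏ B ∈ π, expCoeff G #B) *
        ∑ B ∈ π, ∑ i ∈ B, ∑ j ∈ B, g i j
      = (∑ i ∈ S, g i i) * expCoeff (A.subst G) #S +
        (∑ i ∈ S, ∑ j ∈ S.erase i, g i j) *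
          expCoeff (PowerSeries.derivative ℂ (PowerSeries.derivative ℂ G) *
            (PowerSeries.derivative ℂ A).subst G) (#S - 2) := by
  have h1 : ∀ π ∈ setPartitions S, ∑ B ∈ π, ∑ i ∈ B, ∑ j ∈ B, g i j
      = ∑ i ∈ S, ∑ B ∈ π with i ∈ B, ∑ j ∈ B, g i j := by
    intro π hπ
    refine Finset.sum_comm' fun B i => ?_
    rw [Finset.mem_filter]
    constructor
    · rintro ⟨h, h'⟩
      exact ⟨⟨h, h'⟩, (mem_setPartitions.1 hπ).1 B h h'⟩
    · rintro ⟨h, -⟩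
      exact h
  rw [Finset.sum_congr rfl fun π hπ => by rw [h1 π hπ, Finset.mul_sum], Finset.sum_comm,
    Finset.sum_mul, Finset.sum_mul, ← Finset.sum_add_distrib]
  refine Finset.sum_congr rfl fun i hi => ?_
  rw [sum_setPartitions_prod hi _ _ (fun B => ∑ j ∈ B, g i j)]
  have hc : #(S.erase i) + 1 = #S := Finset.card_erase_add_one hi
  -- In the block `insert i T` of `i`, the partner `j` is either `i` itself, which gives the
  -- diagonal term, or lies in `T`.
  have h2 : ∀ T ∈ (S.erase i).powerset,
      expCoeff G (#T + 1) * (∑ j ∈ insert i T, g i j) *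
        ∑ π ∈ setPartitions (S.erase i \ T), expCoeff A (#π + 1) * ∏ B ∈ π, expCoeff G #B
      = g i i * (expCoeff (PowerSeries.derivative ℂ G) #T *
          expCoeff ((PowerSeries.derivative ℂ A).subst G) #(S.erase i \ T)) +
        (expCoeff (PowerSeries.derivative ℂ G) #T *
          expCoeff ((PowerSeries.derivative ℂ A).subst G) #(S.erase i \ T)) * ∑ j ∈ T, g i j := by
    intro T hT
    have hiT : i ∉ T := fun h' => by simpa using Finset.mem_powerset.1 hT h'
    rw [Finset.sum_insert hiT, ← sum_setPartitions_expCoeff hG, expCoeff_derivative]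
    simp_rw [expCoeff_derivative]
    ring
  rw [Finset.sum_congr rfl h2, Finset.sum_add_distrib, ← Finset.mul_sum,
    sum_powerset_expCoeff_mul, derivative_subst_mul hG, expCoeff_derivative, hc,
    sum_powerset_sum_mem (S.erase i) (fun T => expCoeff (PowerSeries.derivative ℂ G) #T *
          expCoeff ((PowerSeries.derivative ℂ A).subst G) #(S.erase i \ T)) (g i), Finset.sum_mul]
  congr 1
  -- Marking a second element `j` of the same block differentiates `G` again and leaves `#S - 2`
  -- elements to distribute.
  refine Finset.sum_congr rfl fun j hj => ?_
  have hc' : #((S.erase i).erase j) = #S - 2 := by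
    rw [Finset.card_erase_of_mem hj]
    omega
  rw [← hc', ← sum_powerset_expCoeff_mul]
  congr 1
  refine Finset.sum_congr rfl fun T hT => ?_
  have hjT : j ∉ T := fun h' => by simpa using Finset.mem_powerset.1 hT h'
  rw [Finset.card_insert_of_notMem hjT, expCoeff_derivative (PowerSeries.derivative ℂ G)]
  congr 3
  ext k
  simp only [Finset.mem_sdiff, Finset.mem_erase, Finset.mem_insert]
  tauto

end SetPartitions

/-! ### The classical field equation -/

/-- The Minkowski inner product. -/
def minkowskiInner (p q : Momentum) : ℂ := p 0 * q 0 - p 1 * q 1 - p 2 * q 2 - p 3 * q 3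

theorem minkowskiInner_self (p : Momentum) : minkowskiInner p p = minkowskiSq p := by
  simp only [minkowskiInner, minkowskiSq]
  ring

theorem minkowskiSq_sum {α : Type*} (S : Finset α) (q : α → Momentum) :
    minkowskiSq (∑ i ∈ S, q i) = ∑ i ∈ S, ∑ j ∈ S, minkowskiInner (q i) (q j) := by
  simp only [minkowskiInner, minkowskiSq, Finset.sum_apply, Finset.sum_sub_distrib, pow_two,
    Finset.sum_mul_sum]

noncomputable def fieldDiffeoC (a : ℕ → ℝ) : PowerSeries ℂ :=
  PowerSeries.map (algebraMap ℝ ℂ) (fieldDiffeo a)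

theorem constantCoeff_fieldDiffeoC (a : ℕ → ℝ) :
    PowerSeries.constantCoeff (fieldDiffeoC a) = 0 := by
  simp [fieldDiffeoC, fieldDiffeo]

theorem coeff_one_fieldDiffeoC (a : ℕ → ℝ) :
    PowerSeries.coeff 1 (fieldDiffeoC a) = (a 0 : ℂ) := by
  rw [fieldDiffeoC, fieldDiffeo, PowerSeries.coeff_map, PowerSeries.coeff_succ_X_mul,
    PowerSeries.coeff_mk]
  rfl

/-- The power series whose exponential coefficients are the kinematic vertices. -/
noncomputable def kinematicSeries (a : ℕ → ℝ) : PowerSeries ℂ :=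
  PowerSeries.mk fun k => if k = 0 then 0 else (kinematicCoeff a (k - 1) : ℂ) / (k.factorial : ℂ)

/-- The power series whose exponential coefficients are the massive vertices. -/
noncomputable def massiveSeries (a : ℕ → ℝ) (m : ℝ) : PowerSeries ℂ :=
  PowerSeries.derivative ℂ (PowerSeries.C (-((m : ℂ) ^ 2 / 2)) * fieldDiffeoC a ^ 2)

theorem expCoeff_kinematicSeries (a : ℕ → ℝ) {k : ℕ} (hk : k ≠ 0) :
    expCoeff (kinematicSeries a) k = kinematicCoeff a (k - 1) := by
  have : (k.factorial : ℂ) ≠ 0 := Nat.cast_ne_zero.2 (Nat.factorial_ne_zero k)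
  rw [expCoeff, kinematicSeries, PowerSeries.coeff_mk, if_neg hk]
  field_simp

theorem derivative_map_fieldDiffeo (a : ℕ → ℝ) :
    PowerSeries.derivative ℂ (fieldDiffeoC a)
      = PowerSeries.map (algebraMap ℝ ℂ) (PowerSeries.derivative ℝ (fieldDiffeo a)) := by
  ext k
  simp [fieldDiffeoC, PowerSeries.coeff_derivative]

theorem derivative_kinematicSeries (a : ℕ → ℝ) :
    PowerSeries.derivative ℂ (kinematicSeries a)
      = PowerSeries.derivative ℂ (fieldDiffeoC a) ^ 2 := by
  ext k
  have h : (k.factorial : ℂ) ≠ 0 := Nat.cast_ne_zero.2 (Nat.factorial_ne_zero k)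
  apply mul_left_cancel₀ h
  have h1 := expCoeff_derivative (kinematicSeries a) k
  rw [expCoeff] at h1
  rw [h1, expCoeff_kinematicSeries a (Nat.succ_ne_zero k), Nat.succ_eq_add_one, Nat.add_sub_cancel,
    kinematicCoeff_eq, derivative_map_fieldDiffeo,
    ← map_pow (PowerSeries.map (algebraMap ℝ ℂ)), PowerSeries.coeff_map]
  push_cast
  rfl

theorem expCoeff_massiveSeries (a : ℕ → ℝ) (m : ℝ) {k : ℕ} (hk : k ≠ 0) :
    expCoeff (massiveSeries a m) k = massiveCoeff a m (k - 1) := by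
  obtain ⟨k, rfl⟩ := Nat.exists_eq_succ_of_ne_zero hk
  rw [massiveSeries, expCoeff_derivative, Nat.succ_eq_add_one, Nat.add_sub_cancel, massiveCoeff_eq,
    expCoeff, PowerSeries.coeff_C_mul, fieldDiffeoC, ← map_pow, PowerSeries.coeff_map]
  push_cast
  rfl

/-! ### Power series identities behind the field equation -/

section FieldEquation

variable {F G : PowerSeries ℂ}

/-- Differentiate `F(G) = X`. -/
theorem derivative_subst_inverse (hG : PowerSeries.constantCoeff G = 0)
    (hFG : F.subst G = PowerSeries.X) :
    (PowerSeries.derivative ℂ F).subst G * PowerSeries.derivative ℂ G = 1 := by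
  rw [mul_comm, derivative_subst_mul hG, hFG, PowerSeries.derivative_X]

/-- The derivative terms of the field equation cancel. -/
theorem field_equation_pairs (hG : PowerSeries.constantCoeff G = 0)
    (hFG : F.subst G = PowerSeries.X) {W : PowerSeries ℂ}
    (hW : PowerSeries.derivative ℂ W = PowerSeries.derivative ℂ F ^ 2) :
    PowerSeries.derivative ℂ (PowerSeries.derivative ℂ G) * (PowerSeries.derivative ℂ W).subst G +
      PowerSeries.derivative ℂ (PowerSeries.derivative ℂ (W.subst G)) = 0 := by
  have hs := PowerSeries.HasSubst.of_constantCoeff_zero' hG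
  have h1 := derivative_subst_inverse hG hFG
  have h2 := congrArg (PowerSeries.derivative ℂ) h1
  rw [Derivation.leibniz, ← derivative_subst_mul hG, Derivation.map_one_eq_zero, smul_eq_mul,
    smul_eq_mul] at h2
  -- `W'(G) G' = F'(G)² G'`, and one factor `F'(G)` cancels against `G'`.
  have h3 : PowerSeries.derivative ℂ (W.subst G) = (PowerSeries.derivative ℂ F).subst G := by
    rw [← derivative_subst_mul hG, hW, PowerSeries.subst_pow hs]
    linear_combination ((PowerSeries.derivative ℂ F).subst G) * h1
  rw [h3, hW, PowerSeries.subst_pow hs, ← derivative_subst_mul hG]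
  linear_combination ((PowerSeries.derivative ℂ F).subst G) * h2 -
    PowerSeries.derivative ℂ G *
      ((PowerSeries.derivative ℂ (PowerSeries.derivative ℂ F)).subst G) * h1

/-- The mass terms of the field equation cancel. -/
theorem field_equation_mass (hG : PowerSeries.constantCoeff G = 0)
    (hFG : F.subst G = PowerSeries.X) {W : PowerSeries ℂ}
    (hW : PowerSeries.derivative ℂ W = PowerSeries.derivative ℂ F ^ 2) (μ : ℂ) :
    PowerSeries.C μ * (PowerSeries.X * PowerSeries.derivative ℂ (W.subst G)) +
      (PowerSeries.derivative ℂ (PowerSeries.C (-(μ / 2)) * F ^ 2)).subst G = 0 := by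
  have hs := PowerSeries.HasSubst.of_constantCoeff_zero' hG
  have h1 := derivative_subst_inverse hG hFG
  have h3 : PowerSeries.derivative ℂ (W.subst G) = (PowerSeries.derivative ℂ F).subst G := by
    rw [← derivative_subst_mul hG, hW, PowerSeries.subst_pow hs]
    linear_combination ((PowerSeries.derivative ℂ F).subst G) * h1
  have h4 : PowerSeries.derivative ℂ (PowerSeries.C (-(μ / 2)) * F ^ 2)
      = PowerSeries.C (-μ) * (F * PowerSeries.derivative ℂ F) := by
    have : (PowerSeries.C (-μ) : PowerSeries ℂ) = PowerSeries.C (-(μ / 2)) * 2 := by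
      rw [← map_ofNat (PowerSeries.C : ℂ →+* PowerSeries ℂ) 2, ← map_mul]
      congr 1
      ring
    rw [Derivation.leibniz, PowerSeries.derivative_C, PowerSeries.derivative_pow, this,
      smul_eq_mul, smul_eq_mul]
    push_cast
    ring
  have h5 : (PowerSeries.C (-μ) : PowerSeries ℂ).subst G = PowerSeries.C (-μ) :=
    PowerSeries.subst_C _
  rw [h3, h4, PowerSeries.subst_mul hs, PowerSeries.subst_mul hs, hFG, h5, map_neg]
  ring

end FieldEquation

/-- The perturbative solution of the field equation: its coefficients `b` do not depend on the
momenta as long as the external momenta are on the mass shell. -/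
theorem exists_perturbative_solution (a : ℕ → ℝ) (ha : a 0 = 1) (m : ℝ) :
    ∃ b : ℕ → ℂ, b 1 = 1 ∧ ∀ {α : Type} [DecidableEq α] (S : Finset α) (q : α → Momentum),
      S.Nonempty → (∀ i ∈ S, minkowskiSq (q i) = (m : ℂ) ^ 2) →
      ∑ π ∈ setPartitions S, ((kinematicCoeff a (#π - 1) : ℂ) / 2 *
          (minkowskiSq (∑ i ∈ S, q i) + ∑ B ∈ π, minkowskiSq (∑ i ∈ B, q i)) +
          (massiveCoeff a m (#π - 1) : ℂ)) * ∏ B ∈ π, b #B = 0 := by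
  have hu : IsUnit (PowerSeries.coeff 1 (fieldDiffeoC a)) := by
    rw [coeff_one_fieldDiffeoC, ha]
    simp
  have hF0 := constantCoeff_fieldDiffeoC a
  obtain ⟨G, hG, hG1, hFG⟩ : ∃ G : PowerSeries ℂ, PowerSeries.constantCoeff G = 0 ∧
      PowerSeries.coeff 1 G = 1 ∧ (fieldDiffeoC a).subst G = PowerSeries.X := by
    refine ⟨PowerSeries.substInvOfIsUnit _ hu, PowerSeries.constantCoeff_substInvOfIsUnit _ hu, ?_,
      PowerSeries.subst_substInvOfIsUnit_right _ hF0 hu⟩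
    rw [PowerSeries.coeff_one_substInvOfIsUnit]
    have h2 : hu.unit = 1 := by
      ext
      rw [IsUnit.unit_spec, coeff_one_fieldDiffeoC, ha]
      simp
    rw [h2]
    simp
  refine ⟨expCoeff G, by simp [expCoeff, hG1], ?_⟩
  intro α _ S q hS hq
  have hW := derivative_kinematicSeries a
  -- Nonempty partitions keep the truncated `#π - 1` honest and make the constant term chosen for
  -- `kinematicSeries` irrelevant.
  have hpos : ∀ π ∈ setPartitions S, #π ≠ 0 := by
    intro π hπ h
    obtain ⟨i, hi⟩ := hS
    obtain ⟨B, hB, -⟩ := (mem_setPartitions.1 hπ).2.2.1 i hi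
    rw [Finset.card_eq_zero.1 h] at hB
    simp at hB
  have hterm : ∀ π ∈ setPartitions S, ((kinematicCoeff a (#π - 1) : ℂ) / 2 *
          (minkowskiSq (∑ i ∈ S, q i) + ∑ B ∈ π, minkowskiSq (∑ i ∈ B, q i)) +
          (massiveCoeff a m (#π - 1) : ℂ)) * ∏ B ∈ π, expCoeff G #B
      = minkowskiSq (∑ i ∈ S, q i) / 2 *
          (expCoeff (kinematicSeries a) #π * ∏ B ∈ π, expCoeff G #B) +
        1 / 2 * (expCoeff (kinematicSeries a) #π * (∏ B ∈ π, expCoeff G #B) *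
          ∑ B ∈ π, ∑ i ∈ B, ∑ j ∈ B, minkowskiInner (q i) (q j)) +
        expCoeff (massiveSeries a m) #π * ∏ B ∈ π, expCoeff G #B := by
    intro π hπ
    rw [expCoeff_kinematicSeries a (hpos π hπ), expCoeff_massiveSeries a m (hpos π hπ)]
    simp_rw [minkowskiSq_sum]
    ring
  rw [Finset.sum_congr rfl hterm, Finset.sum_add_distrib, Finset.sum_add_distrib, ← Finset.mul_sum,
    ← Finset.mul_sum, sum_setPartitions_expCoeff_pairs hG, sum_setPartitions_expCoeff hG,
    sum_setPartitions_expCoeff hG]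
  -- The mass shell condition enters only through this diagonal sum.
  have hdiag : ∑ i ∈ S, minkowskiInner (q i) (q i) = #S * (m : ℂ) ^ 2 := by
    rw [Finset.sum_congr rfl fun i hi => (minkowskiInner_self (q i)).trans (hq i hi)]
    simp
  have hsq : minkowskiSq (∑ i ∈ S, q i)
      = #S * (m : ℂ) ^ 2 + ∑ i ∈ S, ∑ j ∈ S.erase i, minkowskiInner (q i) (q j) := by
    rw [minkowskiSq_sum, ← hdiag, ← Finset.sum_add_distrib]
    exact Finset.sum_congr rfl fun i hi => (Finset.add_sum_erase S _ hi).symm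
  rw [hsq, hdiag]
  -- The factor `#S` is the effect of `X · d/dX` on an exponential coefficient, which matches
  -- `field_equation_mass`.
  have hmass : (m : ℂ) ^ 2 * (#S * expCoeff ((kinematicSeries a).subst G) #S) +
      expCoeff ((massiveSeries a m).subst G) #S = 0 := by
    obtain ⟨s, hs⟩ := Nat.exists_eq_succ_of_ne_zero hS.card_pos.ne'
    have h := congrArg (fun A => expCoeff A (s + 1)) (field_equation_mass hG hFG hW ((m : ℂ) ^ 2))
    simp only [expCoeff_add] at h
    rw [show ((massiveSeries a m).subst G) = (PowerSeries.derivative ℂ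
      (PowerSeries.C (-((m : ℂ) ^ 2 / 2)) * fieldDiffeoC a ^ 2)).subst G from rfl, hs]
    rw [expCoeff, PowerSeries.coeff_C_mul, mul_left_comm, ← expCoeff, expCoeff_X_mul,
      expCoeff_derivative] at h
    push_cast
    simpa [expCoeff] using h
  have hpairs : (∑ i ∈ S, ∑ j ∈ S.erase i, minkowskiInner (q i) (q j)) *
      (expCoeff (PowerSeries.derivative ℂ (PowerSeries.derivative ℂ G) *
        (PowerSeries.derivative ℂ (kinematicSeries a)).subst G) (#S - 2) +
        expCoeff ((kinematicSeries a).subst G) #S) = 0 := by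
    -- For a singleton `S` there are no pairs `i ≠ j`, so the truncated index `#S - 2` does no harm.
    rcases Nat.lt_or_ge #S 2 with h | h
    · obtain ⟨i, rfl⟩ := Finset.card_eq_one.1 (show #S = 1 by have := hS.card_pos; omega)
      simp
    · have h' := congrArg (fun A => expCoeff A (#S - 2)) (field_equation_pairs hG hFG hW)
      simp only [expCoeff_add, expCoeff_derivative, Nat.sub_add_cancel h] at h'
      rw [h']
      simp [expCoeff]
  linear_combination hmass + (1 / 2) * hpairs

/-! ### Hierarchies -/

theorem singleton_ssubset_of_card {α : Type*} {B : Finset α} (hB : 2 ≤ #B) {i : α} (hi : i ∈ B) :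
    {i} ⊂ B := by
  refine (Finset.singleton_subset_iff.2 hi).ssubset_of_ne fun h => ?_
  rw [← h] at hB
  simp at hB

section Hierarchies

variable {α : Type*} [DecidableEq α]

/-- The hierarchies on `S`: families of nonempty subsets of `S` that contain `S` and all singletons
and any two members of which are nested or disjoint. -/
def hierarchies (S : Finset α) : Finset (Finset (Finset α)) :=
  {H ∈ S.powerset.powerset | ∅ ∉ H ∧ S ∈ H ∧ (∀ i ∈ S, {i} ∈ H) ∧
    ∀ B ∈ H, ∀ C ∈ H, ∀ i ∈ B, i ∈ C → B ⊆ C ∨ C ⊆ B}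

/-- The maximal members of `H` that are properly contained in `B`. -/
def blocks (H : Finset (Finset α)) (B : Finset α) : Finset (Finset α) :=
  {C ∈ H | C ⊂ B ∧ ∀ D ∈ H, C ⊂ D → ¬ D ⊂ B}

theorem mem_hierarchies {S : Finset α} {H : Finset (Finset α)} :
    H ∈ hierarchies S ↔ (∀ B ∈ H, B ⊆ S) ∧ ∅ ∉ H ∧ S ∈ H ∧ (∀ i ∈ S, {i} ∈ H) ∧
      ∀ B ∈ H, ∀ C ∈ H, ∀ i ∈ B, i ∈ C → B ⊆ C ∨ C ⊆ B := by
  simp only [hierarchies, Finset.mem_filter, Finset.mem_powerset, Finset.subset_iff (s₁ := H)]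

theorem mem_blocks {H : Finset (Finset α)} {B C : Finset α} :
    C ∈ blocks H B ↔ C ∈ H ∧ C ⊂ B ∧ ∀ D ∈ H, C ⊂ D → ¬ D ⊂ B := by
  simp only [blocks, Finset.mem_filter]

theorem exists_block_superset {H : Finset (Finset α)} {B C : Finset α} (hC : C ∈ H)
    (hCB : C ⊂ B) : ∃ D ∈ blocks H B, C ⊆ D := by
  obtain ⟨D, hD, hmax⟩ := Finset.exists_max_image {D ∈ H | C ⊆ D ∧ D ⊂ B} Finset.card
    ⟨C, Finset.mem_filter.2 ⟨hC, Finset.Subset.refl _, hCB⟩⟩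
  rw [Finset.mem_filter] at hD
  refine ⟨D, mem_blocks.2 ⟨hD.1, hD.2.2, fun E hE hDE hEB => ?_⟩, hD.2.1⟩
  have := hmax E (Finset.mem_filter.2 ⟨hE, hD.2.1.trans hDE.subset, hEB⟩)
  exact absurd (Finset.card_lt_card hDE) (by omega)

theorem blocks_disjoint {S : Finset α} {H : Finset (Finset α)} (hH : H ∈ hierarchies S)
    {B C D : Finset α} (hC : C ∈ blocks H B) (hD : D ∈ blocks H B) {i : α} (hiC : i ∈ C)
    (hiD : i ∈ D) : C = D := by
  rw [mem_blocks] at hC hD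
  by_contra hne
  rcases (mem_hierarchies.1 hH).2.2.2.2 C hC.1 D hD.1 i hiC hiD with h | h
  · exact hC.2.2 D hD.1 (h.ssubset_of_ne hne) hD.2.1
  · exact hD.2.2 C hC.1 (h.ssubset_of_ne (Ne.symm hne)) hC.2.1

theorem blocks_mem_setPartitions {S : Finset α} {H : Finset (Finset α)} (hH : H ∈ hierarchies S)
    {B : Finset α} (hB : B ∈ H) (hB2 : 2 ≤ #B) : blocks H B ∈ setPartitions B := by
  have hH' := mem_hierarchies.1 hH
  rw [mem_setPartitions]
  refine ⟨fun C hC => (mem_blocks.1 hC).2.1.subset, fun h => hH'.2.1 (mem_blocks.1 h).1, ?_,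
    fun C hC D hD i hi hi' => blocks_disjoint hH hC hD hi hi'⟩
  intro i hi
  obtain ⟨C, hC, hiC⟩ := exists_block_superset (hH'.2.2.2.1 i (hH'.1 B hB hi))
    (singleton_ssubset_of_card hB2 hi)
  exact ⟨C, hC, hiC (Finset.mem_singleton_self i)⟩

/-- This excludes the trivial partition, the term that becomes the inverse propagator in the field
equation. -/
theorem blocks_ne_singleton (H : Finset (Finset α)) (B : Finset α) : blocks H B ≠ {B} := by
  intro h
  have : B ∈ blocks H B := by
    rw [h]
    exact Finset.mem_singleton_self B
  exact (mem_blocks.1 this).2.1.ne rfl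

theorem ssubset_of_mem_setPartition {S B : Finset α} {π : Finset (Finset α)}
    (hπ : π ∈ setPartitions S) (hne : π ≠ {S}) (hB : B ∈ π) : B ⊂ S := by
  obtain ⟨h1, h2, h3, h4⟩ := mem_setPartitions.1 hπ
  refine (h1 B hB).ssubset_of_ne ?_
  rintro rfl
  refine hne (Finset.eq_singleton_iff_unique_mem.2 ⟨hB, fun C hC => ?_⟩)
  obtain ⟨i, hi⟩ := Finset.nonempty_iff_ne_empty.2 (fun h : C = ∅ => h2 (h ▸ hC))
  exact h4 C hC B hB i hi (h1 C hC hi)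

theorem restrict_mem_hierarchies {S B : Finset α} {H : Finset (Finset α)} (hH : H ∈ hierarchies S)
    (hB : B ∈ H) : {C ∈ H | C ⊆ B} ∈ hierarchies B := by
  obtain ⟨h1, h2, h3, h4, h5⟩ := mem_hierarchies.1 hH
  rw [mem_hierarchies]
  simp only [Finset.mem_filter]
  refine ⟨fun C hC => hC.2, fun h => h2 h.1, ⟨hB, Finset.Subset.refl _⟩, fun i hi =>
    ⟨h4 i (h1 B hB hi), Finset.singleton_subset_iff.2 hi⟩, fun C hC D hD => h5 C hC.1 D hD.1⟩

/-- Blocks of `C` depend only on the members inside `C`, so vertex weights survive passing to a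
subtree. -/
theorem blocks_restrict {H : Finset (Finset α)} {B C : Finset α} (hCB : C ⊆ B) :
    blocks {D ∈ H | D ⊆ B} C = blocks H C := by
  ext D
  simp only [mem_blocks, Finset.mem_filter]
  constructor
  · rintro ⟨h1, h2, h3⟩
    exact ⟨h1.1, h2, fun E hE hDE hEC => h3 E ⟨hE, hEC.subset.trans hCB⟩ hDE hEC⟩
  · rintro ⟨h1, h2, h3⟩
    exact ⟨⟨h1, h2.subset.trans hCB⟩, h2, fun E hE => h3 E hE.1⟩

/-- The hierarchy on `S` whose maximal proper members are the blocks of the partition `π` and whose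
restrictions to these blocks are given. -/
def joinHierarchies (S : Finset α) (π : Finset (Finset α))
    (f : ∀ B ∈ π, Finset (Finset α)) : Finset (Finset α) :=
  insert S (π.attach.biUnion fun B => f B.1 B.2)

theorem mem_joinHierarchies {S : Finset α} {π : Finset (Finset α)}
    {f : ∀ B ∈ π, Finset (Finset α)} {C : Finset α} :
    C ∈ joinHierarchies S π f ↔ C = S ∨ ∃ B, ∃ hB : B ∈ π, C ∈ f B hB := by
  simp [joinHierarchies]

/-! ### Gluing hierarchies along a partition -/

section Join

variable {S : Finset α} {π : Finset (Finset α)} {f : ∀ B ∈ π, Finset (Finset α)}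

theorem joinHierarchies_mem (hS : S.Nonempty) (hπ : π ∈ setPartitions S)
    (hf : ∀ B hB, f B hB ∈ hierarchies B) :
    joinHierarchies S π f ∈ hierarchies S := by
  obtain ⟨h1, h2, h3, h4⟩ := mem_setPartitions.1 hπ
  have hsub : ∀ B hB, ∀ C ∈ f B hB, C ⊆ B := fun B hB => (mem_hierarchies.1 (hf B hB)).1
  rw [mem_hierarchies]
  have hle : ∀ C ∈ joinHierarchies S π f, C ⊆ S := by
    intro C hC
    rcases mem_joinHierarchies.1 hC with rfl | ⟨B, hB, hCB⟩
    · exact Finset.Subset.refl _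
    · exact (hsub B hB C hCB).trans (h1 B hB)
  refine ⟨hle, ?_, mem_joinHierarchies.2 (Or.inl rfl), ?_, ?_⟩
  · intro h
    rcases mem_joinHierarchies.1 h with h | ⟨B, hB, hCB⟩
    · exact hS.ne_empty h.symm
    · exact (mem_hierarchies.1 (hf B hB)).2.1 hCB
  · intro i hi
    obtain ⟨B, hB, hiB⟩ := h3 i hi
    exact mem_joinHierarchies.2 (Or.inr ⟨B, hB, (mem_hierarchies.1 (hf B hB)).2.2.2.1 i hiB⟩)
  · intro C hC D hD i hiC hiD
    rcases mem_joinHierarchies.1 hC with rfl | ⟨B, hB, hCB⟩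
    · exact Or.inr (hle D hD)
    rcases mem_joinHierarchies.1 hD with rfl | ⟨B', hB', hDB⟩
    · exact Or.inl (hle C hC)
    obtain rfl := h4 B hB B' hB' i (hsub B hB C hCB hiC) (hsub B' hB' D hDB hiD)
    exact (mem_hierarchies.1 (hf B hB)).2.2.2.2 C hCB D hDB i hiC hiD

theorem blocks_joinHierarchies (hπ : π ∈ setPartitions S) (hne : π ≠ {S})
    (hf : ∀ B hB, f B hB ∈ hierarchies B) : blocks (joinHierarchies S π f) S = π := by
  obtain ⟨h1, h2, h3, h4⟩ := mem_setPartitions.1 hπ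
  have hsub : ∀ B hB, ∀ C ∈ f B hB, C ⊆ B := fun B hB => (mem_hierarchies.1 (hf B hB)).1
  have hmem : ∀ B ∈ π, B ∈ joinHierarchies S π f := fun B hB =>
    mem_joinHierarchies.2 (Or.inr ⟨B, hB, (mem_hierarchies.1 (hf B hB)).2.2.1⟩)
  ext C
  rw [mem_blocks]
  constructor
  · rintro ⟨hC, hCS, hmax⟩
    rcases mem_joinHierarchies.1 hC with rfl | ⟨B, hB, hCB⟩
    · exact absurd rfl hCS.ne
    · by_cases h : C = B
      · rwa [h]
      · exact absurd (ssubset_of_mem_setPartition hπ hne hB)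
          (hmax B (hmem B hB) ((hsub B hB C hCB).ssubset_of_ne h))
  · intro hC
    refine ⟨hmem C hC, ssubset_of_mem_setPartition hπ hne hC, fun D hD hCD hDS => ?_⟩
    rcases mem_joinHierarchies.1 hD with rfl | ⟨B, hB, hDB⟩
    · exact absurd rfl hDS.ne
    · obtain ⟨i, hi⟩ := Finset.nonempty_iff_ne_empty.2 (fun h : C = ∅ => h2 (h ▸ hC))
      obtain rfl := h4 C hC B hB i hi (hsub B hB D hDB (hCD.subset hi))
      exact hCD.2 (hsub C hB D hDB)

theorem restrict_joinHierarchies (hπ : π ∈ setPartitions S) (hne : π ≠ {S})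
    (hf : ∀ B hB, f B hB ∈ hierarchies B) {B : Finset α} (hB : B ∈ π) :
    {C ∈ joinHierarchies S π f | C ⊆ B} = f B hB := by
  obtain ⟨h1, h2, h3, h4⟩ := mem_setPartitions.1 hπ
  have hsub : ∀ B hB, ∀ C ∈ f B hB, C ⊆ B := fun B hB => (mem_hierarchies.1 (hf B hB)).1
  ext C
  rw [Finset.mem_filter, mem_joinHierarchies]
  constructor
  · rintro ⟨rfl | ⟨B', hB', hCB⟩, hC⟩
    · exact absurd hC (ssubset_of_mem_setPartition hπ hne hB).2
    · obtain ⟨i, hi⟩ := Finset.nonempty_iff_ne_empty.2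
        (fun h : C = ∅ => (mem_hierarchies.1 (hf B' hB')).2.1 (h ▸ hCB))
      obtain rfl := h4 B hB B' hB' i (hC hi) (hsub B' hB' C hCB hi)
      exact hCB
  · intro hC
    exact ⟨Or.inr ⟨B, hB, hC⟩, hsub B hB C hC⟩

end Join

theorem joinHierarchies_restrict {S : Finset α} {H : Finset (Finset α)} (hH : H ∈ hierarchies S) :
    joinHierarchies S (blocks H S) (fun B _ => {C ∈ H | C ⊆ B}) = H := by
  obtain ⟨h1, h2, h3, h4, h5⟩ := mem_hierarchies.1 hH
  ext C
  rw [mem_joinHierarchies]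
  constructor
  · rintro (rfl | ⟨B, hB, hC⟩)
    · exact h3
    · exact (Finset.mem_filter.1 hC).1
  · intro hC
    by_cases h : C = S
    · exact Or.inl h
    · obtain ⟨B, hB, hCB⟩ := exists_block_superset hC ((h1 C hC).ssubset_of_ne h)
      exact Or.inr ⟨B, hB, Finset.mem_filter.2 ⟨hC, hCB⟩⟩

/-- The product over the members of `H` with at least two elements of a weight that depends on the
member and on its decomposition into blocks. -/
def hierarchyWeight (u : Finset α → Finset (Finset α) → ℂ) (H : Finset (Finset α)) : ℂ :=
  ∏ B ∈ H with 2 ≤ #B, u B (blocks H B)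

/-- Every member with at least two elements is `S` or lies inside exactly one block of `S`: cutting
at the top vertex factorizes the weight. -/
theorem hierarchyWeight_eq_mul (u : Finset α → Finset (Finset α) → ℂ) {S : Finset α}
    {H : Finset (Finset α)} (hH : H ∈ hierarchies S) (hS : 2 ≤ #S) :
    hierarchyWeight u H
      = u S (blocks H S) * ∏ B ∈ blocks H S, hierarchyWeight u {C ∈ H | C ⊆ B} := by
  obtain ⟨h1, h2, h3, h4, h5⟩ := mem_hierarchies.1 hH
  have hset : {B ∈ H | 2 ≤ #B}
      = insert S ((blocks H S).biUnion fun B => {C ∈ {C ∈ H | C ⊆ B} | 2 ≤ #C}) := by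
    ext C
    simp only [Finset.mem_filter, Finset.mem_insert, Finset.mem_biUnion]
    constructor
    · rintro ⟨hC, hC2⟩
      by_cases h : C = S
      · exact Or.inl h
      · obtain ⟨B, hB, hCB⟩ := exists_block_superset hC ((h1 C hC).ssubset_of_ne h)
        exact Or.inr ⟨B, hB, ⟨hC, hCB⟩, hC2⟩
    · rintro (rfl | ⟨B, hB, hC, hC2⟩)
      · exact ⟨h3, hS⟩
      · exact ⟨hC.1, hC2⟩
  have hnot : S ∉ (blocks H S).biUnion fun B => {C ∈ {C ∈ H | C ⊆ B} | 2 ≤ #C} := by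
    simp only [Finset.mem_filter, Finset.mem_biUnion]
    rintro ⟨B, hB, hC, -⟩
    exact (mem_blocks.1 hB).2.1.2 hC.2
  rw [hierarchyWeight, hset, Finset.prod_insert hnot, Finset.prod_biUnion]
  · congr 1
    refine Finset.prod_congr rfl fun B _ => Finset.prod_congr rfl fun C hC => ?_
    simp only [Finset.mem_filter] at hC
    rw [blocks_restrict hC.1.2]
  · intro B hB B' hB' hne
    refine Finset.disjoint_left.2 fun C hC hC' => hne ?_
    simp only [Finset.mem_filter] at hC hC'
    obtain ⟨i, hi⟩ := Finset.card_pos.1 (show 0 < #C by omega)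
    exact blocks_disjoint hH hB hB' (hC.1.2 hi) (hC'.1.2 hi)

/-- A hierarchy on `S` consists of a partition of `S` into at least two blocks and of hierarchies on
the blocks. -/
theorem sum_hierarchies (u : Finset α → Finset (Finset α) → ℂ) {S : Finset α} (hS : 2 ≤ #S) :
    ∑ H ∈ hierarchies S, hierarchyWeight u H
      = ∑ π ∈ (setPartitions S).erase {S}, u S π *
        ∏ B ∈ π, ∑ H ∈ hierarchies B, hierarchyWeight u H := by
  have hmaps : ∀ H ∈ hierarchies S, blocks H S ∈ (setPartitions S).erase {S} := fun H hH =>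
    Finset.mem_erase.2 ⟨blocks_ne_singleton H S,
      blocks_mem_setPartitions hH (mem_hierarchies.1 hH).2.2.1 hS⟩
  rw [← Finset.sum_fiberwise_of_maps_to hmaps]
  refine Finset.sum_congr rfl fun π hπ => ?_
  obtain ⟨hne, hπ⟩ := Finset.mem_erase.1 hπ
  have hS0 : S.Nonempty := Finset.card_pos.1 (by omega)
  rw [Finset.prod_sum, Finset.mul_sum]
  refine Finset.sum_bij' (fun H _ => fun B _ => {C ∈ H | C ⊆ B})
    (fun f _ => joinHierarchies S π f) ?_ ?_ ?_ ?_ ?_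
  · intro H hH
    rw [Finset.mem_filter] at hH
    obtain ⟨hH, rfl⟩ := hH
    exact Finset.mem_pi.2 fun B hB => restrict_mem_hierarchies hH (mem_blocks.1 hB).1
  · intro f hf
    rw [Finset.mem_pi] at hf
    exact Finset.mem_filter.2 ⟨joinHierarchies_mem hS0 hπ hf, blocks_joinHierarchies hπ hne hf⟩
  · intro H hH
    rw [Finset.mem_filter] at hH
    obtain ⟨hH, rfl⟩ := hH
    exact joinHierarchies_restrict hH
  · intro f hf
    rw [Finset.mem_pi] at hf
    funext B hB
    exact restrict_joinHierarchies hπ hne hf hB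
  · intro H hH
    rw [Finset.mem_filter] at hH
    obtain ⟨hH, rfl⟩ := hH
    rw [hierarchyWeight_eq_mul u hH hS]
    congr 1
    exact (Finset.prod_attach (blocks H S) fun B => hierarchyWeight u {C ∈ H | C ⊆ B}).symm

theorem sum_hierarchies_singleton (u : Finset α → Finset (Finset α) → ℂ) (i : α) :
    ∑ H ∈ hierarchies {i}, hierarchyWeight u H = 1 := by
  have h : hierarchies {i} = {{{i}}} := by
    ext H
    rw [mem_hierarchies, Finset.mem_singleton]
    constructor
    · rintro ⟨h1, h2, h3, -⟩
      refine Finset.eq_singleton_iff_unique_mem.2 ⟨h3, fun B hB => ?_⟩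
      exact (Finset.subset_singleton_iff.1 (h1 B hB)).resolve_left fun h => h2 (h ▸ hB)
    · rintro rfl
      simp [eq_comm]
  rw [h, Finset.sum_singleton, hierarchyWeight, Finset.filter_singleton, if_neg (by simp),
    Finset.prod_empty]

end Hierarchies

/-! ### Rooted trees -/

namespace NumberedTree

variable {n r : ℕ}

/-- `w` is a child of `v`, when the tree is rooted at the external edge `e`. -/
def IsChild (t : NumberedTree n r) (e : Fin n) (v w : Fin r) : Prop :=
  t.graph.Adj v w ∧ ¬ t.Beyond v w (t.attach e)

/-- `x` is `v` or a descendant of `v`, when the tree is rooted at the external edge `e`. -/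
def Below (t : NumberedTree n r) (e : Fin n) (v x : Fin r) : Prop :=
  ∀ w, t.graph.Adj v w → t.Beyond v w (t.attach e) → ¬ t.Beyond v w x

open Classical in
/-- The external edges below `v`. -/
noncomputable def leaves (t : NumberedTree n r) (e : Fin n) (v : Fin r) : Finset (Fin n) :=
  {i | i ≠ e ∧ t.Below e v (t.attach i)}

variable (t : NumberedTree n r) (e : Fin n)

theorem mem_leaves {v : Fin r} {i : Fin n} :
    i ∈ t.leaves e v ↔ i ≠ e ∧ t.Below e v (t.attach i) := by
  simp [leaves]

variable {t e}

theorem isChild_or {v w : Fin r} (h : t.graph.Adj v w) : t.IsChild e v w ∨ t.IsChild e w v := by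
  by_cases hb : t.Beyond v w (t.attach e)
  · exact Or.inr ⟨h.symm, fun h' => t.not_beyond_and h _ ⟨hb, h'⟩⟩
  · exact Or.inl ⟨h, hb⟩

theorem IsChild.beyond {v w : Fin r} (h : t.IsChild e v w) : t.Beyond w v (t.attach e) :=
  (t.beyond_or v w _).resolve_left h.2

theorem IsChild.not_isChild {v w : Fin r} (h : t.IsChild e v w) : ¬ t.IsChild e w v :=
  fun h' => h'.2 h.beyond

theorem isChild_of_beyond {v w : Fin r} (h : t.graph.Adj v w) (hb : t.Beyond v w (t.attach e)) :
    t.IsChild e w v :=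
  ⟨h.symm, fun h' => t.not_beyond_and h _ ⟨hb, h'⟩⟩

theorem IsChild.parent_unique {v v' w : Fin r} (h : t.IsChild e v w) (h' : t.IsChild e v' w) :
    v = v' :=
  t.beyond_unique h.1.symm h'.1.symm h.beyond h'.beyond

theorem exists_parent {v : Fin r} (h : v ≠ t.attach e) : ∃ u, t.IsChild e u v := by
  obtain ⟨w, hw, hb⟩ := (t.exists_beyond v (t.attach e)).resolve_left h.symm
  exact ⟨w, isChild_of_beyond hw hb⟩

theorem not_isChild_root (v : Fin r) : ¬ t.IsChild e v (t.attach e) := fun h =>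
  t.not_beyond_self h.1.symm h.beyond

/-- The edge from `w` to its parent is the only one pointing towards `e`. The definition of `Below`
avoids naming the parent so as to cover the root vertex too. -/
theorem IsChild.below_iff_beyond {v w : Fin r} (h : t.IsChild e v w) (x : Fin r) :
    t.Below e w x ↔ t.Beyond v w x := by
  constructor
  · intro hb
    exact (t.beyond_or v w x).resolve_right (hb v h.1.symm h.beyond)
  · intro hb u hu hue hux
    obtain rfl := t.beyond_unique hu h.1.symm hue h.beyond
    exact t.not_beyond_and h.1 x ⟨hb, hux⟩

theorem below_refl (v : Fin r) : t.Below e v v := fun _ hw _ => t.not_beyond_self hw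

theorem below_root (x : Fin r) : t.Below e (t.attach e) x := fun _ hw hb =>
  absurd hb (t.not_beyond_self hw)

theorem below_iff {v x : Fin r} :
    t.Below e v x ↔ x = v ∨ ∃ w, t.IsChild e v w ∧ t.Below e w x := by
  constructor
  · intro h
    rcases t.exists_beyond v x with h' | ⟨w, hw, hb⟩
    · exact Or.inl h'
    · have hc : t.IsChild e v w := ⟨hw, fun hb' => h w hw hb' hb⟩
      exact Or.inr ⟨w, hc, (hc.below_iff_beyond x).2 hb⟩
  · rintro (rfl | ⟨w, hw, hb⟩)
    · exact below_refl x
    · intro u hu hue hux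
      obtain rfl := t.beyond_unique hu hw.1 hux ((hw.below_iff_beyond x).1 hb)
      exact hw.2 hue

theorem IsChild.below {v w x : Fin r} (h : t.IsChild e v w) (hb : t.Below e w x) :
    t.Below e v x :=
  below_iff.2 (Or.inr ⟨w, h, hb⟩)

theorem IsChild.not_below {v w : Fin r} (h : t.IsChild e v w) : ¬ t.Below e w v := fun hb =>
  t.not_beyond_self h.1 ((h.below_iff_beyond v).1 hb)

theorem IsChild.eq_of_below {v w w' x : Fin r} (h : t.IsChild e v w) (h' : t.IsChild e v w')
    (hb : t.Below e w x) (hb' : t.Below e w' x) : w = w' :=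
  t.beyond_unique h.1 h'.1 ((h.below_iff_beyond x).1 hb) ((h'.below_iff_beyond x).1 hb')

/-- Induction from the leaves to the root. -/
theorem child_induction (t : NumberedTree n r) (e : Fin n) {P : Fin r → Prop}
    (h : ∀ v, (∀ w, t.IsChild e v w → P w) → P v) (v : Fin r) : P v := by
  classical
  induction hs : #{x | t.Below e v x} using Nat.strong_induction_on generalizing v with
  | _ s ih =>
    refine h v fun w hw => ih _ ?_ w rfl
    rw [← hs]
    refine Finset.card_lt_card ⟨fun x hx => ?_, fun hsub => ?_⟩
    · simp only [Finset.mem_filter, Finset.mem_univ, true_and] at hx ⊢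
      exact hw.below hx
    · have := hsub (Finset.mem_filter.2 ⟨Finset.mem_univ v, below_refl v⟩)
      exact hw.not_below (Finset.mem_filter.1 this).2

theorem Below.trans {v x y : Fin r} (h : t.Below e v x) (h' : t.Below e x y) :
    t.Below e v y := by
  induction v using child_induction t e with
  | h v ih =>
    rcases below_iff.1 h with rfl | ⟨w, hw, hb⟩
    · exact h'
    · exact hw.below (ih w hw hb)

theorem Below.below_parent {v w x : Fin r} (hv : t.IsChild e v w) (h : t.Below e x w)
    (hne : x ≠ w) : t.Below e x v := by
  induction x using child_induction t e with
  | h x ih =>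
    obtain ⟨u, hu, hb⟩ := (below_iff.1 h).resolve_left hne.symm
    by_cases huw : u = w
    · subst huw
      obtain rfl := hu.parent_unique hv
      exact below_refl _
    · exact hu.below (ih u hu hb huw)

/-- The ancestors of a vertex form a chain; this is the source of laminarity of the leaf sets. -/
theorem Below.total {v x y : Fin r} (hv : t.Below e v y) (hx : t.Below e x y) :
    t.Below e v x ∨ t.Below e x v := by
  induction v using child_induction t e with
  | h v ih =>
    rcases below_iff.1 hv with rfl | ⟨w, hw, hb⟩
    · exact Or.inr hx
    · rcases ih w hw hb with h | h
      · exact Or.inl (hw.below h)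
      · by_cases hxw : x = w
        · exact Or.inl (hw.below (hxw ▸ below_refl _))
        · exact Or.inr (h.below_parent hw hxw)

theorem leaves_mono {v x : Fin r} (h : t.Below e v x) : t.leaves e x ⊆ t.leaves e v := by
  intro i hi
  rw [mem_leaves] at hi ⊢
  exact ⟨hi.1, h.trans hi.2⟩

theorem mem_leaves_iff {v : Fin r} {i : Fin n} : i ∈ t.leaves e v ↔
    (i ≠ e ∧ t.attach i = v) ∨ ∃ w, t.IsChild e v w ∧ i ∈ t.leaves e w := by
  simp only [mem_leaves]
  rw [below_iff]
  constructor
  · rintro ⟨h, h' | ⟨w, hw, hb⟩⟩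
    · exact Or.inl ⟨h, h'⟩
    · exact Or.inr ⟨w, hw, h, hb⟩
  · rintro (⟨h, h'⟩ | ⟨w, hw, h, hb⟩)
    · exact ⟨h, Or.inl h'⟩
    · exact ⟨h, Or.inr ⟨w, hw, hb⟩⟩

open Classical in
/-- The incident edges of a vertex are those to its children, the external ones other than the
root, and one edge towards the root. -/
theorem valence_eq (t : NumberedTree n r) (e : Fin n) (v : Fin r) :
    t.valence v = #{w | t.IsChild e v w} + #{i | i ≠ e ∧ t.attach i = v} + 1 := by
  unfold valence valenceAt
  by_cases hv : v = t.attach e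
  · have h1 : ({w | t.graph.Adj v w} : Finset (Fin r)) = ({w | t.IsChild e v w} : Finset (Fin r)) := by
      ext w
      simp only [Finset.mem_filter, Finset.mem_univ, true_and]
      refine ⟨fun h => (isChild_or h).resolve_right fun h' => ?_, fun h => h.1⟩
      exact not_isChild_root w (hv ▸ h')
    have h2 : ({i | t.attach i = v} : Finset (Fin n))
        = insert e ({i | i ≠ e ∧ t.attach i = v} : Finset (Fin n)) := by
      ext i
      simp only [Finset.mem_filter, Finset.mem_univ, true_and, Finset.mem_insert]
      by_cases h : i = e
      · simp [h, hv]
      · simp [h]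
    rw [h1, h2, Finset.card_insert_of_notMem (by simp)]
    rfl
  · obtain ⟨u, hu⟩ := exists_parent hv
    have h1 : ({w | t.graph.Adj v w} : Finset (Fin r))
        = insert u ({w | t.IsChild e v w} : Finset (Fin r)) := by
      ext w
      simp only [Finset.mem_filter, Finset.mem_univ, true_and, Finset.mem_insert]
      constructor
      · intro h
        rcases isChild_or h with h' | h'
        · exact Or.inr h'
        · exact Or.inl (h'.parent_unique hu)
      · rintro (rfl | h)
        · exact hu.1.symm
        · exact h.1
    have h2 : ({i | t.attach i = v} : Finset (Fin n))
        = ({i | i ≠ e ∧ t.attach i = v} : Finset (Fin n)) := by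
      ext i
      simp only [Finset.mem_filter, Finset.mem_univ, true_and]
      refine ⟨fun h => ⟨?_, h⟩, fun h => h.2⟩
      rintro rfl
      exact hv h.symm
    rw [h1, h2, Finset.card_insert_of_notMem (by simpa using hu.not_isChild)]
    ring

/-- Besides the edge towards the root, `v` has at least two incident edges; each leads to a leaf,
and these leaves are distinct. -/
theorem two_le_card_leaves (t : NumberedTree n r) (e : Fin n) (v : Fin r) :
    2 ≤ #(t.leaves e v) := by
  classical
  induction v using child_induction t e with
  | h v ih =>
    have h3 := t.three_le_valence v
    rw [← valence, valence_eq t e v] at h3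
    have hsub : ({w | t.IsChild e v w} : Finset (Fin r)).biUnion (t.leaves e) ∪
        ({i | i ≠ e ∧ t.attach i = v} : Finset (Fin n)) ⊆ t.leaves e v := by
      intro i hi
      rw [mem_leaves_iff]
      simp only [Finset.mem_union, Finset.mem_biUnion, Finset.mem_filter, Finset.mem_univ,
        true_and] at hi
      exact hi.symm
    refine le_trans ?_ (Finset.card_le_card hsub)
    rw [Finset.card_union_of_disjoint, Finset.card_biUnion]
    · have : #({w | t.IsChild e v w} : Finset (Fin r)) * 1
          ≤ ∑ w with t.IsChild e v w, #(t.leaves e w) :=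
        Finset.card_nsmul_le_sum _ _ _ fun w hw =>
          le_trans (by norm_num) (ih w (Finset.mem_filter.1 hw).2)
      omega
    · intro w hw w' hw' hne
      refine Finset.disjoint_left.2 fun i hi hi' => hne ?_
      rw [mem_leaves] at hi hi'
      simp only [Finset.coe_filter, Set.mem_ofPred_eq, Finset.mem_univ, true_and] at hw hw'
      exact hw.eq_of_below hw' hi.2 hi'.2
    · refine Finset.disjoint_left.2 fun i hi hi' => ?_
      simp only [Finset.mem_biUnion, Finset.mem_filter, Finset.mem_univ, true_and] at hi hi'
      obtain ⟨w, hw, hiw⟩ := hi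
      rw [mem_leaves, hi'.2] at hiw
      exact hw.not_below hiw.2

/-- Valence at least three gives `v` a second downward branch, whose leaves are not below `w`. Hence
vertices can be recovered from their leaf sets. -/
theorem IsChild.leaves_ssubset {v w : Fin r} (h : t.IsChild e v w) :
    t.leaves e w ⊂ t.leaves e v := by
  classical
  refine (leaves_mono (h.below (below_refl w))).ssubset_of_ne fun heq => ?_
  have h3 := t.three_le_valence v
  rw [← valence, valence_eq t e v] at h3
  by_cases hleaf : ∃ i, i ≠ e ∧ t.attach i = v
  · obtain ⟨i, hi⟩ := hleaf
    have : i ∈ t.leaves e w := by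
      rw [heq, mem_leaves_iff]
      exact Or.inl hi
    rw [mem_leaves, hi.2] at this
    exact h.not_below this.2
  · have h0 : #({i | i ≠ e ∧ t.attach i = v} : Finset (Fin n)) = 0 := by
      rw [Finset.card_eq_zero, Finset.filter_eq_empty_iff]
      exact fun i _ hi => hleaf ⟨i, hi⟩
    obtain ⟨w', hw', hne⟩ := Finset.exists_mem_ne
      (show 1 < #({w | t.IsChild e v w} : Finset (Fin r)) by omega) w
    have hw' : t.IsChild e v w' := by simpa using hw'
    obtain ⟨i, hi⟩ := Finset.card_pos.1
      (show 0 < #(t.leaves e w') by have := two_le_card_leaves t e w'; omega)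
    have hi' : i ∈ t.leaves e w := by
      rw [heq, mem_leaves_iff]
      exact Or.inr ⟨w', hw', hi⟩
    rw [mem_leaves] at hi hi'
    exact hne (hw'.eq_of_below h hi.2 hi'.2)

theorem Below.leaves_ssubset {v x : Fin r} (h : t.Below e v x) (hne : x ≠ v) :
    t.leaves e x ⊂ t.leaves e v := by
  obtain ⟨w, hw, hb⟩ := (below_iff.1 h).resolve_left hne
  exact lt_of_le_of_lt (leaves_mono hb) hw.leaves_ssubset

theorem leaves_subset_or {v x : Fin r} {i : Fin n} (hv : i ∈ t.leaves e v)
    (hx : i ∈ t.leaves e x) : t.Below e v x ∨ t.Below e x v :=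
  ((mem_leaves t e).1 hv).2.total ((mem_leaves t e).1 hx).2

theorem leaves_subset_iff {v x : Fin r} : t.leaves e x ⊆ t.leaves e v ↔ t.Below e v x := by
  refine ⟨fun h => ?_, leaves_mono⟩
  obtain ⟨i, hi⟩ := Finset.card_pos.1
    (show 0 < #(t.leaves e x) by have := two_le_card_leaves t e x; omega)
  rcases leaves_subset_or (h hi) hi with h' | h'
  · exact h'
  · by_cases hne : v = x
    · exact hne ▸ below_refl v
    · exact absurd h (h'.leaves_ssubset hne).2

theorem leaves_injective (t : NumberedTree n r) (e : Fin n) :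
    Function.Injective (t.leaves e) := fun v x h => by
  by_contra hne
  exact ((leaves_subset_iff.1 h.subset).leaves_ssubset hne).ne h

theorem leaves_root (t : NumberedTree n r) (e : Fin n) :
    t.leaves e (t.attach e) = Finset.univ.erase e := by
  ext i
  simp [mem_leaves, below_root]

/-! ### The hierarchy of a rooted tree -/

/-- The hierarchy of the sets of external edges below the vertices of a rooted tree. -/
noncomputable def hierarchy (t : NumberedTree n r) (e : Fin n) : Finset (Finset (Fin n)) :=
  Finset.univ.image (t.leaves e) ∪ (Finset.univ.erase e).image fun i => {i}

theorem mem_hierarchy {B : Finset (Fin n)} :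
    B ∈ t.hierarchy e ↔ (∃ v, t.leaves e v = B) ∨ ∃ i, i ≠ e ∧ {i} = B := by
  simp [hierarchy]

theorem leaves_mem_hierarchy (v : Fin r) : t.leaves e v ∈ t.hierarchy e :=
  mem_hierarchy.2 (Or.inl ⟨v, rfl⟩)

theorem leaves_ne_singleton (v : Fin r) (i : Fin n) : t.leaves e v ≠ {i} := fun h => by
  have := two_le_card_leaves t e v
  rw [h] at this
  simp at this

theorem hierarchy_mem_hierarchies (t : NumberedTree n r) (e : Fin n) :
    t.hierarchy e ∈ hierarchies (Finset.univ.erase e) := by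
  rw [mem_hierarchies]
  refine ⟨?_, ?_, ?_, ?_, ?_⟩
  · intro B hB
    rcases mem_hierarchy.1 hB with ⟨v, rfl⟩ | ⟨i, hi, rfl⟩
    · intro i hi
      simpa using ((mem_leaves t e).1 hi).1
    · simpa using hi
  · intro h
    rcases mem_hierarchy.1 h with ⟨v, hv⟩ | ⟨i, hi, h⟩
    · have := two_le_card_leaves t e v
      rw [hv] at this
      simp at this
    · exact Finset.singleton_ne_empty i h
  · rw [← leaves_root t e]
    exact leaves_mem_hierarchy _
  · intro i hi
    exact mem_hierarchy.2 (Or.inr ⟨i, by simpa using hi, rfl⟩)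
  · intro B hB C hC i hiB hiC
    rcases mem_hierarchy.1 hB with ⟨v, rfl⟩ | ⟨j, hj, rfl⟩
    · rcases mem_hierarchy.1 hC with ⟨w, rfl⟩ | ⟨k, hk, rfl⟩
      · rw [leaves_subset_iff, leaves_subset_iff]
        exact (leaves_subset_or hiB hiC).symm
      · obtain rfl := Finset.mem_singleton.1 hiC
        exact Or.inr (Finset.singleton_subset_iff.2 hiB)
    · obtain rfl := Finset.mem_singleton.1 hiB
      exact Or.inl (Finset.singleton_subset_iff.2 hiC)

/-- Leaf sets reflect the order of the tree, so being a maximal proper member translates into being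
a child. -/
theorem leaves_mem_blocks {v w : Fin r} :
    t.leaves e w ∈ blocks (t.hierarchy e) (t.leaves e v) ↔ t.IsChild e v w := by
  rw [mem_blocks]
  constructor
  · rintro ⟨-, h, hmax⟩
    have hb := leaves_subset_iff.1 h.subset
    have hne : w ≠ v := by
      rintro rfl
      exact h.ne rfl
    obtain ⟨u, hu, huw⟩ := (below_iff.1 hb).resolve_left hne
    by_cases h' : w = u
    · exact h' ▸ hu
    · exact absurd hu.leaves_ssubset
        (hmax _ (leaves_mem_hierarchy u) (huw.leaves_ssubset h'))
  · intro h
    refine ⟨leaves_mem_hierarchy w, h.leaves_ssubset, fun D hD hwD hDv => ?_⟩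
    rcases mem_hierarchy.1 hD with ⟨x, rfl⟩ | ⟨i, hi, rfl⟩
    · have hne : x ≠ w := by
        rintro rfl
        exact hwD.ne rfl
      have := (leaves_subset_iff.1 hwD.subset).below_parent h hne
      exact hDv.2 (leaves_mono this)
    · have := Finset.card_lt_card hwD
      have := two_le_card_leaves t e w
      simp only [Finset.card_singleton] at *
      omega

theorem singleton_mem_blocks {v : Fin r} {i : Fin n} :
    {i} ∈ blocks (t.hierarchy e) (t.leaves e v) ↔ i ≠ e ∧ t.attach i = v := by
  rw [mem_blocks]
  constructor
  · rintro ⟨-, h, hmax⟩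
    rcases mem_leaves_iff.1 (Finset.singleton_subset_iff.1 h.subset) with h' | ⟨w, hw, hi⟩
    · exact h'
    · exact absurd hw.leaves_ssubset (hmax _ (leaves_mem_hierarchy w)
        (singleton_ssubset_of_card (two_le_card_leaves t e w) hi))
  · intro h
    refine ⟨mem_hierarchy.2 (Or.inr ⟨i, h.1, rfl⟩), singleton_ssubset_of_card
      (two_le_card_leaves t e v) (mem_leaves_iff.2 (Or.inl h)), fun D hD hiD hDv => ?_⟩
    rcases mem_hierarchy.1 hD with ⟨x, rfl⟩ | ⟨j, hj, rfl⟩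
    · have := ((mem_leaves t e).1 (Finset.singleton_subset_iff.1 hiD.subset)).2
      rw [h.2] at this
      exact hDv.2 (leaves_mono this)
    · have := Finset.card_lt_card hiD
      simp at this

open Classical in
theorem blocks_hierarchy (t : NumberedTree n r) (e : Fin n) (v : Fin r) :
    blocks (t.hierarchy e) (t.leaves e v)
      = ({w | t.IsChild e v w} : Finset (Fin r)).image (t.leaves e) ∪
        ({i | i ≠ e ∧ t.attach i = v} : Finset (Fin n)).image fun i => {i} := by
  ext B
  simp only [Finset.mem_union, Finset.mem_image, Finset.mem_filter, Finset.mem_univ, true_and]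
  constructor
  · intro hB
    rcases mem_hierarchy.1 (mem_blocks.1 hB).1 with ⟨w, rfl⟩ | ⟨i, hi, rfl⟩
    · exact Or.inl ⟨w, leaves_mem_blocks.1 hB, rfl⟩
    · exact Or.inr ⟨i, singleton_mem_blocks.1 hB, rfl⟩
  · rintro (⟨w, hw, rfl⟩ | ⟨i, hi, rfl⟩)
    · exact leaves_mem_blocks.2 hw
    · exact singleton_mem_blocks.2 hi

open Classical in
theorem sum_blocks_hierarchy {M : Type*} [AddCommMonoid M] (t : NumberedTree n r) (e : Fin n)
    (v : Fin r) (f : Finset (Fin n) → M) :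
    ∑ B ∈ blocks (t.hierarchy e) (t.leaves e v), f B
      = ∑ w with t.IsChild e v w, f (t.leaves e w) + ∑ i with i ≠ e ∧ t.attach i = v, f {i} := by
  rw [blocks_hierarchy, Finset.sum_union, Finset.sum_image, Finset.sum_image]
  · intro i _ j _ h
    exact Finset.singleton_injective h
  · intro v _ w _ h
    exact leaves_injective t e h
  · refine Finset.disjoint_left.2 fun B hB hB' => ?_
    obtain ⟨w, -, rfl⟩ := Finset.mem_image.1 hB
    obtain ⟨i, -, h⟩ := Finset.mem_image.1 hB'
    exact leaves_ne_singleton w i h.symm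

/-- The extra `1` is the edge towards the root; thus the vertex index `valence - 2` becomes `#π -
1`. -/
theorem valence_eq_card_blocks (t : NumberedTree n r) (e : Fin n) (v : Fin r) :
    t.valence v = #(blocks (t.hierarchy e) (t.leaves e v)) + 1 := by
  classical
  rw [Finset.card_eq_sum_ones, sum_blocks_hierarchy, valence_eq t e v]
  simp

theorem filter_hierarchy (t : NumberedTree n r) (e : Fin n) :
    {B ∈ t.hierarchy e | 2 ≤ #B} = Finset.univ.image (t.leaves e) := by
  ext B
  simp only [Finset.mem_filter, mem_hierarchy, Finset.mem_image, Finset.mem_univ, true_and]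
  constructor
  · rintro ⟨h | ⟨i, -, rfl⟩, h2⟩
    · exact h
    · simp at h2
  · rintro ⟨v, rfl⟩
    exact ⟨Or.inl ⟨v, rfl⟩, two_le_card_leaves t e v⟩

theorem card_filter_hierarchy (t : NumberedTree n r) (e : Fin n) :
    #{B ∈ t.hierarchy e | 2 ≤ #B} = r := by
  rw [filter_hierarchy, Finset.card_image_of_injective _ (leaves_injective t e), Finset.card_univ,
    Fintype.card_fin]

theorem hierarchyWeight_hierarchy (u : Finset (Fin n) → Finset (Finset (Fin n)) → ℂ)
    (t : NumberedTree n r) (e : Fin n) : hierarchyWeight u (t.hierarchy e)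
      = ∏ v, u (t.leaves e v) (blocks (t.hierarchy e) (t.leaves e v)) := by
  rw [hierarchyWeight, filter_hierarchy, Finset.prod_image]
  exact fun v _ w _ h => leaves_injective t e h

end NumberedTree

/-! ### Feynman rules in terms of hierarchies -/

namespace NumberedTree

variable {n r : ℕ} {t : NumberedTree n r} {e : Fin n}

theorem IsChild.flow_eq {v w : Fin r} (h : t.IsChild e v w) (p : ExternalMomenta n) :
    t.flow p v w = ∑ i ∈ t.leaves e w, p.mom i := by
  classical
  unfold flow
  refine Finset.sum_congr ?_ fun _ _ => rfl
  ext i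
  rw [Finset.mem_filter, mem_leaves, h.below_iff_beyond]
  refine ⟨fun hi => ⟨?_, hi.2⟩, fun hi => ⟨Finset.mem_univ i, hi.2⟩⟩
  rintro rfl
  exact h.2 hi.2

theorem _root_.ExternalMomenta.mom_eq_neg_sum (p : ExternalMomenta n) (e : Fin n) :
    p.mom e = -∑ i ∈ Finset.univ.erase e, p.mom i := by
  rw [eq_neg_iff_add_eq_zero, Finset.add_sum_erase _ _ (Finset.mem_univ e), p.sum_eq_zero]

-- The edge towards the root carries, up to sign, the total momentum of the leaves below `v`. At the
-- root vertex this edge is `e` itself, and overall momentum conservation gives the same value.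
open Classical in
theorem sum_minkowskiSq_incident (p : ExternalMomenta n) (t : NumberedTree n r) (e : Fin n)
    (v : Fin r) :
    ∑ w with t.graph.Adj v w, minkowskiSq (t.flow p v w) +
        ∑ i with t.attach i = v, minkowskiSq (p.mom i)
      = minkowskiSq (∑ i ∈ t.leaves e v, p.mom i) +
        ∑ B ∈ blocks (t.hierarchy e) (t.leaves e v), minkowskiSq (∑ i ∈ B, p.mom i) := by
  have hc : ∑ w with t.IsChild e v w, minkowskiSq (t.flow p v w)
      = ∑ w with t.IsChild e v w, minkowskiSq (∑ i ∈ t.leaves e w, p.mom i) :=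
    Finset.sum_congr rfl fun w hw => by rw [(Finset.mem_filter.1 hw).2.flow_eq p]
  rw [sum_blocks_hierarchy, ← hc]
  simp only [Finset.sum_singleton]
  by_cases hv : v = t.attach e
  · have h1 : ({w | t.graph.Adj v w} : Finset (Fin r))
        = ({w | t.IsChild e v w} : Finset (Fin r)) := by
      ext w
      simp only [Finset.mem_filter, Finset.mem_univ, true_and]
      refine ⟨fun h => (isChild_or h).resolve_right fun h' => ?_, fun h => h.1⟩
      exact not_isChild_root w (hv ▸ h')
    have h2 : ({i | t.attach i = v} : Finset (Fin n))
        = insert e ({i | i ≠ e ∧ t.attach i = v} : Finset (Fin n)) := by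
      ext i
      simp only [Finset.mem_filter, Finset.mem_univ, true_and, Finset.mem_insert]
      by_cases h : i = e
      · simp [h, hv]
      · simp [h]
    have h3 : minkowskiSq (p.mom e) = minkowskiSq (∑ i ∈ t.leaves e v, p.mom i) := by
      rw [p.mom_eq_neg_sum e, minkowskiSq_neg, hv, leaves_root]
    rw [h1, h2, Finset.sum_insert (by simp), h3]
    ring
  · obtain ⟨u, hu⟩ := exists_parent hv
    have h1 : ({w | t.graph.Adj v w} : Finset (Fin r))
        = insert u ({w | t.IsChild e v w} : Finset (Fin r)) := by
      ext w
      simp only [Finset.mem_filter, Finset.mem_univ, true_and, Finset.mem_insert]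
      constructor
      · intro h
        rcases isChild_or h with h' | h'
        · exact Or.inr h'
        · exact Or.inl (h'.parent_unique hu)
      · rintro (rfl | h)
        · exact hu.1.symm
        · exact h.1
    have h2 : ({i | t.attach i = v} : Finset (Fin n))
        = ({i | i ≠ e ∧ t.attach i = v} : Finset (Fin n)) := by
      ext i
      simp only [Finset.mem_filter, Finset.mem_univ, true_and]
      refine ⟨fun h => ⟨?_, h⟩, fun h => h.2⟩
      rintro rfl
      exact hv h.symm
    have h3 : minkowskiSq (t.flow p v u) = minkowskiSq (∑ i ∈ t.leaves e v, p.mom i) := by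
      rw [t.flow_swap p hu.1, minkowskiSq_neg, hu.flow_eq p]
    rw [h1, h2, Finset.sum_insert (by simpa using hu.not_isChild), h3]
    ring

-- Each internal edge is assigned to its lower endpoint, which is a bijection onto the vertices
-- other than the root vertex.
open Classical in
theorem prod_edges (m : ℝ) (p : ExternalMomenta n) (t : NumberedTree n r) (e : Fin n) :
    ∏ x : Fin r × Fin r with x.1 < x.2 ∧ t.graph.Adj x.1 x.2, propagator m p t x.1 x.2
      = ∏ v, if t.leaves e v = Finset.univ.erase e then 1
          else Complex.I / (minkowskiSq (∑ i ∈ t.leaves e v, p.mom i) - (m : ℂ) ^ 2) := by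
  have hroot : ∀ v, t.leaves e v = Finset.univ.erase e ↔ v = t.attach e := fun v => by
    rw [← leaves_root t e]
    exact (leaves_injective t e).eq_iff
  have hprop : ∀ v w, t.IsChild e v w → propagator m p t v w
      = Complex.I / (minkowskiSq (∑ i ∈ t.leaves e w, p.mom i) - (m : ℂ) ^ 2) := by
    intro v w h
    rw [propagator, h.flow_eq p]
  simp only [hroot]
  rw [Finset.prod_ite, Finset.prod_const_one, one_mul]
  refine Finset.prod_bij (fun x _ => if t.IsChild e x.1 x.2 then x.2 else x.1) ?_ ?_ ?_ ?_
  · rintro ⟨v, w⟩ hx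
    simp only [Finset.mem_filter, Finset.mem_univ, true_and] at hx ⊢
    split_ifs with h
    · rintro rfl
      exact not_isChild_root v h
    · rintro rfl
      exact not_isChild_root w ((isChild_or hx.2).resolve_left h)
  · rintro ⟨v, w⟩ hx ⟨v', w'⟩ hx' heq
    simp only [Finset.mem_filter, Finset.mem_univ, true_and] at hx hx' heq
    split_ifs at heq with h h' h'
    · subst heq
      rw [h.parent_unique h']
    · subst heq
      obtain rfl := h.parent_unique ((isChild_or hx'.2).resolve_left h')
      exact absurd hx.1 hx'.1.asymm
    · subst heq
      obtain rfl := h'.parent_unique ((isChild_or hx.2).resolve_left h)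
      exact absurd hx.1 hx'.1.asymm
    · subst heq
      rw [((isChild_or hx.2).resolve_left h).parent_unique ((isChild_or hx'.2).resolve_left h')]
  · intro v hv
    simp only [Finset.mem_filter, Finset.mem_univ, true_and] at hv
    obtain ⟨u, hu⟩ := exists_parent hv
    rcases lt_or_gt_of_ne hu.1.ne with h | h
    · exact ⟨(u, v), by simp [h, hu.1], by simp [hu]⟩
    · exact ⟨(v, u), by simp [h, hu.1.symm], by simp [hu.not_isChild]⟩
  · rintro ⟨v, w⟩ hx
    simp only [Finset.mem_filter, Finset.mem_univ, true_and] at hx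
    split_ifs with h
    · exact hprop v w h
    · rw [← propagator_swap m p t hx.2]
      exact hprop w v ((isChild_or hx.2).resolve_left h)

/-- The factor of a vertex and of the edge towards the root, expressed by the set `B` of the
external edges below the vertex and its decomposition `π`. -/
noncomputable def _root_.blockWeight (a : ℕ → ℝ) (m : ℝ) (p : ExternalMomenta n) (e : Fin n)
    (B : Finset (Fin n)) (π : Finset (Finset (Fin n))) : ℂ :=
  (Complex.I * ((kinematicCoeff a (#π - 1) : ℂ) / 2) *
      (minkowskiSq (∑ i ∈ B, p.mom i) + ∑ C ∈ π, minkowskiSq (∑ i ∈ C, p.mom i)) +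
    Complex.I * (massiveCoeff a m (#π - 1) : ℂ)) *
  if B = Finset.univ.erase e then 1
  else Complex.I / (minkowskiSq (∑ i ∈ B, p.mom i) - (m : ℂ) ^ 2)

theorem contribution_eq_hierarchyWeight (a : ℕ → ℝ) (m : ℝ) (p : ExternalMomenta n)
    (t : NumberedTree n r) (e : Fin n) :
    contribution a m p t = hierarchyWeight (blockWeight a m p e) (t.hierarchy e) := by
  classical
  rw [hierarchyWeight_hierarchy, contribution, prod_edges m p t e, ← Finset.prod_mul_distrib]
  refine Finset.prod_congr rfl fun v _ => ?_
  rw [vertexFactor, sum_minkowskiSq_incident p t e v, valence_eq_card_blocks t e v, blockWeight]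
  rfl

theorem leaves_iso {t' : NumberedTree n r} (f : t.graph ≃g t'.graph)
    (hf : ∀ i, t'.attach i = f (t.attach i)) (v : Fin r) : t'.leaves e (f v) = t.leaves e v := by
  ext i
  rw [mem_leaves, mem_leaves, hf]
  refine and_congr_right fun _ => ?_
  unfold Below
  rw [hf, ← f.toEquiv.forall_congr_right]
  simp only [RelIso.coe_fn_toEquiv, beyond_iso_iff f, f.map_adj_iff]

theorem hierarchy_congr {t t' : NumberedTree n r} (e : Fin n) (h : t ≈ t') :
    t.hierarchy e = t'.hierarchy e := by
  obtain ⟨f, hf⟩ := h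
  ext B
  rw [mem_hierarchy, mem_hierarchy]
  refine or_congr ?_ Iff.rfl
  rw [← f.toEquiv.exists_congr_right (q := fun v => t'.leaves e v = B)]
  simp only [RelIso.coe_fn_toEquiv, leaves_iso f hf]

/-- Adjacency can be read off the hierarchy alone, which is why the hierarchy determines the tree up
to renumbering. -/
theorem adj_iff_blocks {v w : Fin r} : t.graph.Adj v w ↔
    t.leaves e w ∈ blocks (t.hierarchy e) (t.leaves e v) ∨
      t.leaves e v ∈ blocks (t.hierarchy e) (t.leaves e w) := by
  rw [leaves_mem_blocks, leaves_mem_blocks]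
  exact ⟨isChild_or, fun h => h.elim (fun h => h.1) fun h => h.1.symm⟩

theorem equivalent_of_hierarchy_eq {t t' : NumberedTree n r} (e : Fin n)
    (h : t.hierarchy e = t'.hierarchy e) : t ≈ t' := by
  -- The isomorphism matches vertices with equal leaf sets; singletons in the hierarchy cannot
  -- interfere, since leaf sets have at least two elements.
  have hex : ∀ v, ∃ w, t'.leaves e w = t.leaves e v := by
    intro v
    have hv := leaves_mem_hierarchy (t := t) (e := e) v
    rw [h] at hv
    exact (mem_hierarchy.1 hv).resolve_right fun ⟨i, _, hi⟩ => leaves_ne_singleton v i hi.symm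
  choose f hf using hex
  have hinj : Function.Injective f := fun v w hvw =>
    leaves_injective t e (by rw [← hf, ← hf, hvw])
  refine ⟨⟨Equiv.ofBijective f (Finite.injective_iff_bijective.1 hinj), ?_⟩, fun i => ?_⟩
  · intro v w
    change t'.graph.Adj (f v) (f w) ↔ t.graph.Adj v w
    rw [adj_iff_blocks (e := e), adj_iff_blocks (e := e), hf, hf, h]
  · change t'.attach i = f (t.attach i)
    by_cases hi : i = e
    · subst hi
      refine leaves_injective t' i ?_
      rw [hf, leaves_root, leaves_root]
    · refine (singleton_mem_blocks (e := e).1 ?_).2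
      rw [hf, ← h]
      exact singleton_mem_blocks.2 ⟨hi, rfl⟩

end NumberedTree

/-! ### From hierarchies back to trees -/

/-- Iterating `parent` reaches the root because `depth` drops, so the graph is connected. Every edge
joins a non-root vertex to its parent, so there are at most `|V| - 1` edges. -/
theorem SimpleGraph.isTree_of_parent {V : Type*} [Finite V] {G : SimpleGraph V} (root : V)
    (parent : V → V) (depth : V → ℕ) (hadj : ∀ v, v ≠ root → G.Adj v (parent v))
    (hdepth : ∀ v, v ≠ root → depth (parent v) < depth v)
    (hG : ∀ v w, G.Adj v w → (v ≠ root ∧ parent v = w) ∨ (w ≠ root ∧ parent w = v)) :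
    G.IsTree := by
  classical
  have hreach : ∀ v, G.Reachable v root := by
    intro v
    induction hd : depth v using Nat.strong_induction_on generalizing v with
    | _ d ih =>
      by_cases hv : v = root
      · rw [hv]
      · exact (hadj v hv).reachable.trans (ih _ (hd ▸ hdepth v hv) _ rfl)
  have hconn : G.Connected :=
    { preconnected := fun v w => (hreach v).trans (hreach w).symm
      nonempty := ⟨root⟩ }
  rw [SimpleGraph.isTree_iff_connected_and_card]
  refine ⟨hconn, le_antisymm ?_ hconn.card_vert_le_card_edgeSet_add_one⟩
  have hsub : G.edgeSet ⊆ (fun v => s(v, parent v)) '' {v | v ≠ root} := by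
    intro x
    induction x using Sym2.ind with
    | _ v w =>
      intro h
      rcases hG v w h with ⟨h1, rfl⟩ | ⟨h1, rfl⟩
      · exact ⟨v, h1, rfl⟩
      · exact ⟨w, h1, Sym2.eq_swap⟩
  have h1 : Nat.card G.edgeSet ≤ Nat.card {v | v ≠ root} := by
    rw [Nat.card_coe_set_eq, Nat.card_coe_set_eq]
    exact (Set.ncard_le_ncard hsub (Set.toFinite _)).trans (Set.ncard_image_le (Set.toFinite _))
  have h2 : Nat.card {v | v ≠ root} + 1 = Nat.card V := by
    rw [Nat.card_coe_set_eq, ← Set.ncard_univ, show {v | v ≠ root} = Set.univ \ {root} by ext; simp]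
    exact Set.ncard_sdiff_singleton_add_one (Set.mem_univ _) (Set.toFinite _)
  omega

section Hierarchies

variable {α : Type*} [DecidableEq α]

/-- A smallest member strictly containing `B` serves as its parent. -/
theorem exists_mem_blocks {S B : Finset α} {H : Finset (Finset α)} (hH : H ∈ hierarchies S)
    (hB : B ∈ H) (hne : B ≠ S) : ∃ C ∈ H, 2 ≤ #C ∧ B ∈ blocks H C := by
  obtain ⟨h1, h2, h3, -⟩ := mem_hierarchies.1 hH
  obtain ⟨C, hC, hmin⟩ := Finset.exists_min_image {C ∈ H | B ⊂ C} Finset.card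
    ⟨S, Finset.mem_filter.2 ⟨h3, (h1 B hB).ssubset_of_ne hne⟩⟩
  rw [Finset.mem_filter] at hC
  have hpos : 0 < #B := Finset.card_pos.2
    (Finset.nonempty_iff_ne_empty.2 fun h : B = ∅ => h2 (h ▸ hB))
  have hlt := Finset.card_lt_card hC.2
  refine ⟨C, hC.1, by omega, mem_blocks.2 ⟨hB, hC.2, fun D hD hBD hDC => ?_⟩⟩
  have := hmin D (Finset.mem_filter.2 ⟨hD, hBD⟩)
  exact absurd (Finset.card_lt_card hDC) (by omega)

theorem eq_of_mem_blocks {S B C D : Finset α} {H : Finset (Finset α)} (hH : H ∈ hierarchies S)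
    (hC : C ∈ H) (hD : D ∈ H) (hBC : B ∈ blocks H C) (hBD : B ∈ blocks H D) : C = D := by
  obtain ⟨h1, h2, h3, h4, h5⟩ := mem_hierarchies.1 hH
  rw [mem_blocks] at hBC hBD
  obtain ⟨i, hi⟩ := Finset.nonempty_iff_ne_empty.2 fun h : B = ∅ => h2 (h ▸ hBC.1)
  by_contra hne
  rcases h5 C hC D hD i (hBC.2.1.subset hi) (hBD.2.1.subset hi) with h | h
  · exact hBD.2.2 C hC hBC.2.1 (h.ssubset_of_ne hne)
  · exact hBC.2.2 D hD hBD.2.1 (h.ssubset_of_ne (Ne.symm hne))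

/-- A block is a proper subset, so one block cannot cover `B`. This provides valence at least three
in the reconstructed tree. -/
theorem two_le_card_blocks {S B : Finset α} {H : Finset (Finset α)} (hH : H ∈ hierarchies S)
    (hB : B ∈ H) (hB2 : 2 ≤ #B) : 2 ≤ #(blocks H B) := by
  have hπ := blocks_mem_setPartitions hH hB hB2
  obtain ⟨h1, h2, h3, h4⟩ := mem_setPartitions.1 hπ
  obtain ⟨i, hi⟩ := Finset.card_pos.1 (show 0 < #B by omega)
  obtain ⟨C, hC, hiC⟩ := h3 i hi
  obtain ⟨j, hj, hjC⟩ := Finset.exists_of_ssubset (mem_blocks.1 hC).2.1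
  obtain ⟨D, hD, hjD⟩ := h3 j hj
  refine Finset.one_lt_card.2 ⟨C, hC, D, hD, ?_⟩
  rintro rfl
  exact hjC hjD

end Hierarchies

namespace NumberedTree

/-- Every hierarchy on the external edges other than the root comes from a tree. -/
theorem exists_hierarchy_eq {n : ℕ} (e : Fin n) (hn : 3 ≤ n) {H : Finset (Finset (Fin n))}
    (hH : H ∈ hierarchies (Finset.univ.erase e)) :
    ∃ t : NumberedTree n #{B ∈ H | 2 ≤ #B}, t.hierarchy e = H := by
  classical
  obtain ⟨h1, h2, h3, h4, h5⟩ := mem_hierarchies.1 hH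
  have hcard : #(Finset.univ.erase e) = n - 1 := by
    rw [Finset.card_erase_of_mem (Finset.mem_univ e), Finset.card_univ, Fintype.card_fin]
  obtain ⟨s, hs, hsH, hs2, hex⟩ : ∃ s : Fin #{B ∈ H | 2 ≤ #B} → Finset (Fin n),
      Function.Injective s ∧ (∀ v, s v ∈ H) ∧ (∀ v, 2 ≤ #(s v)) ∧
      ∀ B ∈ H, 2 ≤ #B → ∃ v, s v = B := by
    let f := Finset.equivFin {B ∈ H | 2 ≤ #B}
    refine ⟨fun v => (f.symm v).1, fun v w h => f.symm.injective (Subtype.ext h),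
      fun v => (Finset.mem_filter.1 (f.symm v).2).1, fun v => (Finset.mem_filter.1 (f.symm v).2).2,
      fun B hB hB2 => ⟨f ⟨B, Finset.mem_filter.2 ⟨hB, hB2⟩⟩, by simp⟩⟩
  obtain ⟨root, hroot⟩ := hex _ h3 (by omega)
  have hpar : ∀ v, ∃ w, v ≠ root → s v ∈ blocks H (s w) := by
    intro v
    by_cases hv : v = root
    · exact ⟨root, fun h => absurd hv h⟩
    · obtain ⟨C, hC, hC2, hb⟩ := exists_mem_blocks hH (hsH v) fun h => hv (hs (h.trans hroot.symm))
      obtain ⟨w, rfl⟩ := hex C hC hC2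
      exact ⟨w, fun _ => hb⟩
  choose parent hparent using hpar
  -- The edge `e` is attached at the top vertex, any other edge at the parent of its singleton.
  have hatt : ∀ i, ∃ w, (i ≠ e → {i} ∈ blocks H (s w)) ∧ (i = e → w = root) := by
    intro i
    by_cases hi : i = e
    · exact ⟨root, fun h => absurd hi h, fun _ => rfl⟩
    · have hne : ({i} : Finset (Fin n)) ≠ Finset.univ.erase e := by
        intro h
        rw [← h] at hcard
        simp only [Finset.card_singleton] at hcard
        omega
      obtain ⟨C, hC, hC2, hb⟩ := exists_mem_blocks hH (h4 i (by simpa using hi)) hne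
      obtain ⟨w, rfl⟩ := hex C hC hC2
      exact ⟨w, fun _ => hb, fun h => absurd h hi⟩
  choose att hatt hatte using hatt
  have hss : ∀ {v w}, s v ∈ blocks H (s w) → s v ⊂ s w := fun h => (mem_blocks.1 h).2.1
  let G : SimpleGraph (Fin #{B ∈ H | 2 ≤ #B}) :=
    { Adj := fun v w => s w ∈ blocks H (s v) ∨ s v ∈ blocks H (s w)
      symm := ⟨fun v w h => h.symm⟩
      loopless := ⟨fun v h => (hss (h.elim id id)).ne rfl⟩ }
  have hnr : ∀ {v w}, s v ∈ blocks H (s w) → v ≠ root := by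
    rintro v w h rfl
    exact (hss h).2 (hroot ▸ h1 _ (hsH w))
  have hpeq : ∀ {v w}, s v ∈ blocks H (s w) → parent v = w := fun {v w} h =>
    hs (eq_of_mem_blocks hH (hsH _) (hsH _) (hparent v (hnr h)) h)
  have hblock : ∀ v, ∀ C ∈ blocks H (s v),
      (∃ w, s w ∈ blocks H (s v) ∧ s w = C) ∨ ∃ i, (i ≠ e ∧ att i = v) ∧ {i} = C := by
    intro v C hC
    have hCH := (mem_blocks.1 hC).1
    by_cases hC2 : 2 ≤ #C
    · obtain ⟨w, rfl⟩ := hex C hCH hC2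
      exact Or.inl ⟨w, hC, rfl⟩
    · have hpos : 0 < #C := Finset.card_pos.2
        (Finset.nonempty_iff_ne_empty.2 fun h : C = ∅ => h2 (h ▸ hCH))
      obtain ⟨i, rfl⟩ := Finset.card_eq_one.1 (show #C = 1 by omega)
      have hi : i ≠ e := by simpa using h1 _ hCH
      exact Or.inr ⟨i, ⟨hi, hs (eq_of_mem_blocks hH (hsH _) (hsH _) (hatt i hi) hC)⟩, rfl⟩
  have hval : ∀ v, 3 ≤ valenceAt G att v := by
    intro v
    have hb := two_le_card_blocks hH (hsH v) (hs2 v)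
    have hsub : blocks H (s v)
        ⊆ ({w | s w ∈ blocks H (s v)} : Finset (Fin #{B ∈ H | 2 ≤ #B})).image s ∪
          ({i | i ≠ e ∧ att i = v} : Finset (Fin n)).image fun i => {i} := by
      intro C hC
      simpa using hblock v C hC
    have hle := (Finset.card_le_card hsub).trans ((Finset.card_union_le _ _).trans
      (Nat.add_le_add Finset.card_image_le Finset.card_image_le))
    have hunfold : valenceAt G att v = #{w | G.Adj v w} + #{i | att i = v} := by
      unfold valenceAt
      congr!
    rw [hunfold]
    -- The edge beyond those counted by the blocks is `e` at the root vertex and the edge to the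
    -- parent elsewhere.
    by_cases hv : v = root
    · have g1 : #({w | s w ∈ blocks H (s v)} : Finset (Fin #{B ∈ H | 2 ≤ #B}))
          ≤ #{w | G.Adj v w} := Finset.card_le_card fun w hw => by
        simp only [Finset.mem_filter, Finset.mem_univ, true_and] at hw ⊢
        exact Or.inl hw
      have g2 : #({i | i ≠ e ∧ att i = v} : Finset (Fin n)) < #{i | att i = v} := by
        refine Finset.card_lt_card ⟨fun i hi => ?_, fun h => ?_⟩
        · simp only [Finset.mem_filter, Finset.mem_univ, true_and] at hi ⊢
          exact hi.2
        · have := h (Finset.mem_filter.2 ⟨Finset.mem_univ e, (hatte e rfl).trans hv.symm⟩)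
          simp at this
      omega
    · have g1 : #({w | s w ∈ blocks H (s v)} : Finset (Fin #{B ∈ H | 2 ≤ #B}))
          < #{w | G.Adj v w} := by
        refine Finset.card_lt_card ⟨fun w hw => ?_, fun h => ?_⟩
        · simp only [Finset.mem_filter, Finset.mem_univ, true_and] at hw ⊢
          exact Or.inl hw
        · have := h (Finset.mem_filter.2 ⟨Finset.mem_univ (parent v), Or.inr (hparent v hv)⟩)
          simp only [Finset.mem_filter, Finset.mem_univ, true_and] at this
          exact (hss this).asymm (hss (hparent v hv))
      have g2 : #({i | i ≠ e ∧ att i = v} : Finset (Fin n)) ≤ #{i | att i = v} :=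
        Finset.card_le_card fun i hi => by
          simp only [Finset.mem_filter, Finset.mem_univ, true_and] at hi ⊢
          exact hi.2
      omega
  -- Leaf sets grow towards the root, so the size of the complement serves as depth.
  have hdepth : ∀ v, v ≠ root → n - #(s (parent v)) < n - #(s v) := by
    intro v hv
    have g1 := Finset.card_lt_card (hss (hparent v hv))
    have g2 := Finset.card_le_univ (s (parent v))
    rw [Fintype.card_fin] at g2
    omega
  have htree : G.IsTree := by
    refine SimpleGraph.isTree_of_parent root parent (fun v => n - #(s v))
      (fun v hv => Or.inr (hparent v hv)) hdepth ?_
    rintro v w (h | h)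
    · exact Or.inr ⟨hnr h, hpeq h⟩
    · exact Or.inl ⟨hnr h, hpeq h⟩
  let t : NumberedTree n #{B ∈ H | 2 ≤ #B} := ⟨G, htree, att, hval⟩
  have hchild' : ∀ {v w}, s w ∈ blocks H (s v) → t.IsChild e v w := by
    intro v w h
    have hadj : t.graph.Adj v w := Or.inl h
    -- Climbing to the root from `v` or any vertex with a larger set never uses the edge from `v`
    -- down to `w`.
    have hup : ∀ x, s v ⊆ s x → (t.graph.deleteEdges {s(w, v)}).Reachable x root := by
      intro x
      induction hd : n - #(s x) using Nat.strong_induction_on generalizing x with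
      | _ d ih =>
        intro hx
        by_cases hxr : x = root
        · rw [hxr]
        · have hp := hss (hparent x hxr)
          refine (SimpleGraph.Adj.reachable ?_).trans
            (ih _ (hd ▸ hdepth x hxr) (parent x) rfl (hx.trans hp.subset))
          rw [SimpleGraph.deleteEdges_adj]
          refine ⟨Or.inr (hparent x hxr), fun he => ?_⟩
          rcases Sym2.eq_iff.1 (Set.mem_singleton_iff.1 he) with ⟨rfl, -⟩ | ⟨rfl, hw⟩
          · exact (hss h).2 hx
          · rw [hw] at hp
            exact hp.asymm (hss h)
    refine ⟨hadj, fun hb => t.not_beyond_and hadj _ ⟨hb, ?_⟩⟩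
    have := hup v (Finset.Subset.refl _)
    rw [← hatte e rfl] at this
    exact this
  have hchild : ∀ {v w}, t.IsChild e v w ↔ s w ∈ blocks H (s v) := by
    intro v w
    refine ⟨fun h => ?_, hchild'⟩
    rcases h.1 with h' | h'
    · exact h'
    · exact absurd (hchild' h') h.not_isChild
  have hleaves : ∀ v, t.leaves e v = s v := by
    intro v
    induction v using child_induction t e with
    | h v ih =>
      ext i
      rw [mem_leaves_iff]
      constructor
      · rintro (⟨hi, rfl⟩ | ⟨w, hw, hiw⟩)
        · exact Finset.singleton_subset_iff.1 (mem_blocks.1 (hatt i hi)).2.1.subset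
        · rw [ih w hw] at hiw
          exact (hss (hchild.1 hw)).subset hiw
      · intro hi
        obtain ⟨C, hC, hiC⟩ :=
          (mem_setPartitions.1 (blocks_mem_setPartitions hH (hsH v) (hs2 v))).2.2.1 i hi
        rcases hblock v C hC with ⟨w, hw, rfl⟩ | ⟨j, hj, rfl⟩
        · exact Or.inr ⟨w, hchild.2 hw, by rwa [ih w (hchild.2 hw)]⟩
        · obtain rfl := Finset.mem_singleton.1 hiC
          exact Or.inl hj
  refine ⟨t, ?_⟩
  ext B
  rw [mem_hierarchy]
  simp only [hleaves]
  constructor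
  · rintro (⟨v, rfl⟩ | ⟨i, hi, rfl⟩)
    · exact hsH v
    · exact h4 i (by simpa using hi)
  · intro hB
    by_cases hB2 : 2 ≤ #B
    · exact Or.inl (hex B hB hB2)
    · have hpos : 0 < #B := Finset.card_pos.2
        (Finset.nonempty_iff_ne_empty.2 fun h : B = ∅ => h2 (h ▸ hB))
      obtain ⟨i, rfl⟩ := Finset.card_eq_one.1 (show #B = 1 by omega)
      exact Or.inr ⟨i, by simpa using h1 _ hB, rfl⟩

end NumberedTree

/-! ### The amplitude as a sum over hierarchies and its vanishing -/

theorem treeAmplitude_eq_sum_hierarchies (a : ℕ → ℝ) (m : ℝ) {n : ℕ} (hn : 3 ≤ n)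
    (p : ExternalMomenta n) (e : Fin n) : treeAmplitude a m p
      = ∑ H ∈ hierarchies (Finset.univ.erase e), hierarchyWeight (blockWeight a m p e) H := by
  have hmaps : ∀ H ∈ hierarchies (Finset.univ.erase e),
      #{B ∈ H | 2 ≤ #B} ∈ Finset.range (n - 1) := by
    intro H hH
    obtain ⟨t, -⟩ := NumberedTree.exists_hierarchy_eq e hn hH
    have := t.add_two_le
    rw [Finset.mem_range]
    omega
  -- Hierarchies are sorted by their number of non-singleton members, which is the number of
  -- vertices of the tree.
  rw [treeAmplitude, ← Finset.sum_fiberwise_of_maps_to hmaps]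
  refine Finset.sum_congr rfl fun r _ => ?_
  refine Finset.sum_bij (fun T _ => Quotient.lift (fun t => NumberedTree.hierarchy t e)
    (fun _ _ h => NumberedTree.hierarchy_congr e h) T) ?_ ?_ ?_ ?_
  · intro T _
    induction T using Quotient.ind with
    | _ t =>
      exact Finset.mem_filter.2 ⟨t.hierarchy_mem_hierarchies e, t.card_filter_hierarchy e⟩
  · intro T _ T' _ h
    induction T using Quotient.ind with
    | _ t =>
      induction T' using Quotient.ind with
      | _ t' => exact Quotient.sound (NumberedTree.equivalent_of_hierarchy_eq e h)
  · intro H hH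
    obtain ⟨hH', rfl⟩ := Finset.mem_filter.1 hH
    obtain ⟨t, ht⟩ := NumberedTree.exists_hierarchy_eq e hn hH'
    exact ⟨Quotient.mk _ t, Finset.mem_univ _, ht⟩
  · intro T _
    induction T using Quotient.ind with
    | _ t => exact t.contribution_eq_hierarchyWeight a m p e

theorem mainTheorem3 (a : ℕ → ℝ) (ha : a 0 = 1) (m : ℝ) (hm : m ≠ 0) (n : ℕ) (hn : 3 ≤ n)
    (p : ExternalMomenta n) (hshell : p.OnShell m) (hreg : p.Nonsingular m) :
    treeAmplitude a m p = 0 := by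
  obtain ⟨b, hb1, hb⟩ := exists_perturbative_solution a ha m
  -- Any external edge could serve as the root.
  let e : Fin n := ⟨0, by omega⟩
  have hcard : #(Finset.univ.erase e) = n - 1 := by
    rw [Finset.card_erase_of_mem (Finset.mem_univ e), Finset.card_univ, Fintype.card_fin]
  -- the sum over the partitions of `S` other than the trivial one
  have hrec : ∀ S : Finset (Fin n), S.Nonempty →
      ∑ π ∈ (setPartitions S).erase {S}, ((kinematicCoeff a (#π - 1) : ℂ) / 2 *
          (minkowskiSq (∑ i ∈ S, p.mom i) + ∑ B ∈ π, minkowskiSq (∑ i ∈ B, p.mom i)) +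
          (massiveCoeff a m (#π - 1) : ℂ)) * ∏ B ∈ π, b #B
        = -((minkowskiSq (∑ i ∈ S, p.mom i) - (m : ℂ) ^ 2) * b #S) := by
    intro S hS
    have hmem : {S} ∈ setPartitions S := by
      rw [mem_setPartitions]
      simp only [Finset.mem_singleton]
      refine ⟨fun B hB => hB.subset, fun h => hS.ne_empty h.symm, fun i hi => ⟨S, rfl, hi⟩, ?_⟩
      rintro B rfl C rfl
      simp
    have h := hb S p.mom hS fun i _ => hshell i
    rw [← Finset.add_sum_erase _ _ hmem] at h
    rw [eq_neg_of_add_eq_zero_right h]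
    -- The trivial partition is a formal two-valent vertex: `d_0 = 1` and `c_0 = -m²` make it the
    -- inverse propagator.
    have hk : kinematicCoeff a 0 = 1 := by simp [kinematicCoeff, ha]
    have hc : massiveCoeff a m 0 = -m ^ 2 := by simp [massiveCoeff, ha]
    simp only [Finset.card_singleton, Nat.sub_self, hk, hc, Finset.sum_singleton,
      Finset.prod_singleton]
    push_cast
    ring
  -- One step of the recursion, both for inner currents and for the top set, where the propagator is
  -- replaced by `1`.
  have hsum : ∀ S : Finset (Fin n), 2 ≤ #S → (∀ B, B ⊂ S → B.Nonempty →
        ∑ H ∈ hierarchies B, hierarchyWeight (blockWeight a m p e) H = b #B) →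
      ∑ H ∈ hierarchies S, hierarchyWeight (blockWeight a m p e) H
        = -(Complex.I * ((minkowskiSq (∑ i ∈ S, p.mom i) - (m : ℂ) ^ 2) * b #S)) *
          if S = Finset.univ.erase e then 1
          else Complex.I / (minkowskiSq (∑ i ∈ S, p.mom i) - (m : ℂ) ^ 2) := by
    intro S hS hB
    rw [sum_hierarchies _ hS, ← mul_neg, ← hrec S (Finset.card_pos.1 (by omega)), Finset.mul_sum,
      Finset.sum_mul]
    refine Finset.sum_congr rfl fun π hπ => ?_
    obtain ⟨hne, hπ⟩ := Finset.mem_erase.1 hπ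
    have hprod : ∏ B ∈ π, ∑ H ∈ hierarchies B, hierarchyWeight (blockWeight a m p e) H
        = ∏ B ∈ π, b #B := Finset.prod_congr rfl fun B hBπ =>
      hB B (ssubset_of_mem_setPartition hπ hne hBπ) (Finset.nonempty_iff_ne_empty.2
        fun h : B = ∅ => (mem_setPartitions.1 hπ).2.1 (h ▸ hBπ))
    rw [hprod, blockWeight]
    ring
  have hcurrent : ∀ B, B ⊂ Finset.univ.erase e → B.Nonempty →
      ∑ H ∈ hierarchies B, hierarchyWeight (blockWeight a m p e) H = b #B := by
    intro B
    induction B using Finset.strongInduction with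
    | H B ih =>
      intro hBS hBne
      rcases Nat.lt_or_ge #B 2 with h | h
      · obtain ⟨i, rfl⟩ := Finset.card_eq_one.1 (show #B = 1 by have := hBne.card_pos; omega)
        rw [sum_hierarchies_singleton, Finset.card_singleton, hb1]
      · rw [hsum B h fun C hC hCne => ih C hC (hC.trans hBS) hCne, if_neg hBS.ne]
        have hlt := Finset.card_lt_card hBS
        -- The complement contains `e` and at least one more edge, as `B` is a proper subset of the
        -- remaining ones.
        have hcompl : 2 ≤ #Bᶜ := by
          rw [Finset.card_compl, Fintype.card_fin]
          omega
        have hne := sub_ne_zero.2 (hreg B h hcompl)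
        field_simp
        rw [Complex.I_sq]
        ring
  rw [treeAmplitude_eq_sum_hierarchies a m hn p e, hsum _ (by omega) hcurrent]
  -- The uncancelled inverse propagator at the top is that of the on-shell edge `e`, hence zero.
  have hlast : minkowskiSq (∑ i ∈ Finset.univ.erase e, p.mom i) = (m : ℂ) ^ 2 := by
    rw [← hshell e, p.mom_eq_neg_sum e, minkowskiSq_neg]
  rw [hlast]
  simp
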